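/- **Theorem (Strong Feller).** Let $M$ be a $d$-dimensional real-analytic manifold (Hausdorff, second countable, without boundary), and let $\mathcal F=\{Y_1,Y_2,Y_3\}$ be complete real-analytic vector fields on $M$ with flows $\psi^{(1)}_t,\psi^{(2)}_t,\psi^{(3)}_t$. Let $h>0$ and let $\underline\tau=(\tau_1,\tau_2,\dots)$ be independent exponential random variables with mean $h$. The random splitting chain is defined by $\Psi^0_{\underline\tau}=I$ and $$\Psi^m_{\underline\tau}=\psi^{(3)}_{\tau_{3m}}\circ\psi^{(2)}_{\tau_{3m-1}}\circ\psi^{(1)}_{\tau_{3m-2}}\circ\Psi^{m-1}_{\underline\tau},\qquad m\ge 1.$$ Let $Q(x,D)=\mathbb P(\Psi^1_{\underline\tau}(x)\in D)$ be its transition kernel, acting on bounded measurable functions by $Qg(x)=\int_M g(y)\,Q(x,dy)$, with iterates $Q^m$. Let $\mathrm{Lie}(\mathcal F)$ be the smallest linear space of vector fields that contains $\mathcal F$ and is closed under Lie brackets, and let $\mathrm{Lie}_x(\mathcal F)=\{V(x):V\in\mathrm{Lie}(\mathcal F)\}\subset T_xM$. Assume that $\mathrm{Lie}_{x_0}(\mathcal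 F)=T_{x_0}M$ for some $x_0\in M$. Then there exist an integer $m\ge 1$ and an open neighborhood $U$ of $x_0$ such that $Q^m$ is strong Feller on $U$, that is, for every bounded measurable function $g:M\to\mathbb R$ the function $Q^mg$ is continuous on $U$. -/

import Mathlib

open MeasureTheory ProbabilityTheory
open scoped Manifold ContDiff Topology

/-- A vector field on `M` (no regularity), as a section of the tangent bundle. -/
abbrev VectorFieldOn (d : ℕ) (M : Type*) [TopologicalSpace M]
    [ChartedSpace (EuclideanSpace ℝ (Fin d)) M] :=
  (x : M) → TangentSpace (𝓡 d) x

/-- A vector field is analytic if it is an analytic section of the tangent bundle. -/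
def IsAnalyticVectorField {d : ℕ} {M : Type*} [TopologicalSpace M]
    [ChartedSpace (EuclideanSpace ℝ (Fin d)) M] [IsManifold (𝓡 d) ω M]
    (V : VectorFieldOn d M) : Prop :=
  haveI : IsManifold (𝓡 d) 1 M := IsManifold.of_le (n := ω) le_top
  ContMDiff (𝓡 d) (𝓡 d).tangent ω
    (fun x : M ↦ (⟨x, V x⟩ : TangentBundle (𝓡 d) M))

/-- A vector field is complete if through every point there is an integral curve defined for
all times. -/
def IsCompleteVectorField {d : ℕ} {M : Type*} [TopologicalSpace M]
    [ChartedSpace (EuclideanSpace ℝ (Fin d)) M]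
    (V : VectorFieldOn d M) : Prop :=
  ∀ x : M, ∃ γ : ℝ → M, γ 0 = x ∧ IsMIntegralCurve (I := 𝓡 d) γ V

open Classical in
/-- The flow of a vector field `V`: the map `t ↦ vectorFlow V t x` is the integral curve of `V`
that starts at `x` (it exists if `V` is complete, and is then unique for a `C^1` field on a
Hausdorff manifold). The value `x` is a default where there is no global integral curve. -/
noncomputable def vectorFlow {d : ℕ} {M : Type*} [TopologicalSpace M]
    [ChartedSpace (EuclideanSpace ℝ (Fin d)) M]
    (V : VectorFieldOn d M) (t : ℝ) (x : M) : M :=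
  if hx : ∃ γ : ℝ → M, γ 0 = x ∧ IsMIntegralCurve (I := 𝓡 d) γ V then hx.choose t else x

/-- `Lie(F)` for a finite family `F` of vector fields: the smallest linear space of vector fields
that contains the family and is closed under Lie brackets. -/
noncomputable def lieHull {d : ℕ} {M : Type*} [TopologicalSpace M]
    [ChartedSpace (EuclideanSpace ℝ (Fin d)) M]
    (Y : Fin 3 → VectorFieldOn d M) : Submodule ℝ (VectorFieldOn d M) :=
  sInf {S | (∀ i, Y i ∈ S) ∧
    ∀ V ∈ S, ∀ W ∈ S, VectorField.mlieBracket (𝓡 d) V W ∈ S}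

/-- `Lie_x(F)`: the subspace of the tangent space at `x` formed by the values at `x` of the
vector fields in `Lie(F)`. -/
noncomputable def lieHullAt {d : ℕ} {M : Type*} [TopologicalSpace M]
    [ChartedSpace (EuclideanSpace ℝ (Fin d)) M]
    (Y : Fin 3 → VectorFieldOn d M) (x : M) : Submodule ℝ (TangentSpace (𝓡 d) x) :=
  (lieHull Y).map (LinearMap.proj x)

/-- The splitting `Ψ^m` for a deterministic sequence of times `t`: here `t n` is the time that is
usually written `t_{n+1}`, and `Y 0`, `Y 1`, `Y 2` are the three vector fields, which act in this
order in each step. -/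
noncomputable def splitting {d : ℕ} {M : Type*} [TopologicalSpace M]
    [ChartedSpace (EuclideanSpace ℝ (Fin d)) M]
    (Y : Fin 3 → VectorFieldOn d M) (t : ℕ → ℝ) : ℕ → M → M
  | 0, x => x
  | m + 1, x =>
      vectorFlow (Y 2) (t (3 * m + 2)) (vectorFlow (Y 1) (t (3 * m + 1))
        (vectorFlow (Y 0) (t (3 * m)) (splitting Y t m x)))

/-- The transition kernel `Q(x, D) = P(Ψ_τ(x) ∈ D)` of the random splitting chain with random
times `τ`. -/
noncomputable def splittingKernel {d : ℕ} {M : Type*} [TopologicalSpace M]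
    [ChartedSpace (EuclideanSpace ℝ (Fin d)) M] [MeasurableSpace M]
    {Ω : Type*} [MeasurableSpace Ω] (P : Measure Ω)
    (Y : Fin 3 → VectorFieldOn d M) (τ : ℕ → Ω → ℝ) (x : M) : Measure M :=
  P.map (fun o ↦ splitting Y (fun n ↦ τ n o) 1 x)

/-- The action `(κ g)(x) = ∫ g(y) κ(x, dy)` of a kernel on functions. -/
noncomputable def kernelOperator {M : Type*} [MeasurableSpace M]
    (κ : M → Measure M) (g : M → ℝ) (x : M) : ℝ :=
  ∫ y, g y ∂(κ x)

/-- The operator `T` on functions is strong Feller on `U`: for every bounded measurable `g` on the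
whole space, `T g` is continuous on `U`. -/
def StrongFellerOn {M : Type*} [TopologicalSpace M] [MeasurableSpace M]
    (T : (M → ℝ) → M → ℝ) (U : Set M) : Prop :=
  ∀ g : M → ℝ, Measurable g → (∃ C : ℝ, ∀ x, |g x| ≤ C) → ContinuousOn (T g) U

/-!
Among the finite sequences of times whose splitting endpoint stays close to `x₀`, choose one that
maximizes the rank of the differential of the endpoint as a function of the times. Near that
sequence the set of endpoints is an immersed submanifold, and each `Y i` is tangent to it: a step
with all times zero may be appended freely, and moving one of its times along `Y i` cannot raise the
rank. Brackets of tangent fields are tangent, so all of `lieHull Y` is tangent, and since its values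
span the tangent space near `x₀`, the endpoint map is a submersion at these times.

For every `x` near `x₀` the endpoint map from `x` is then still a submersion somewhere, hence,
being analytic, at almost all times. Locally a submersion pushes Lebesgue measure to a measure
with bounded density, uniformly in `x`; approximating a bounded measurable `g` by continuous
functions in `L¹` shows that `g` composed with the endpoint map depends continuously on `x` in
`L¹` of the times. Since the times have an absolutely continuous law, `Q^m g` is continuous near
`x₀`.
-/

/-! ### Analytic flows -/

section Superposition

variable {𝕜 K E F : Type*} [NontriviallyNormedField 𝕜] [TopologicalSpace K] [CompactSpace K]
  [NormedAddCommGroup E] [NormedSpace 𝕜 E] [NormedAddCommGroup F] [NormedSpace 𝕜 F]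

variable (K) in
/-- The formal power series on `C(K, E)` obtained by applying a formal power series on `E`
pointwise; it is the expansion of the superposition operator `γ ↦ V ∘ γ` of an analytic `V`. -/
noncomputable def pointwiseSeries (p : FormalMultilinearSeries 𝕜 E F) :
    FormalMultilinearSeries 𝕜 C(K, E) C(K, F) := fun n ↦
  MultilinearMap.mkContinuous
    { toFun := fun m ↦
        ⟨fun s ↦ p n fun i ↦ m i s, (p n).cont.comp (continuous_pi fun i ↦ (m i).continuous)⟩
      map_update_add' := fun m i γ η ↦ by
        ext s
        exact ((p n).compContinuousLinearMap fun _ ↦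
          ContinuousMap.evalCLM 𝕜 s).map_update_add m i γ η
      map_update_smul' := fun m i c γ ↦ by
        ext s
        exact ((p n).compContinuousLinearMap fun _ ↦
          ContinuousMap.evalCLM 𝕜 s).map_update_smul m i c γ }
    ‖p n‖ fun m ↦ (ContinuousMap.norm_le _ (by positivity)).2 fun s ↦
      ((p n).le_opNorm _).trans (by
        gcongr with i
        exact (m i).norm_coe_le_norm s)

lemma radius_le_radius_pointwiseSeries (p : FormalMultilinearSeries 𝕜 E F) :
    p.radius ≤ (pointwiseSeries K p).radius :=
  FormalMultilinearSeries.radius_le_of_le fun _ ↦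
    MultilinearMap.mkContinuous_norm_le _ (norm_nonneg _) _

lemma pointwiseSeries_sum_apply [CompleteSpace F] {p : FormalMultilinearSeries 𝕜 E F} {V : E → F}
    {x : E} {r : ENNReal} (hp : HasFPowerSeriesOnBall V p x r) {γ : C(K, E)} (hγ : ‖γ‖ₑ < r)
    (s : K) : (pointwiseSeries K p).sum γ s = V (x + γ s) := by
  have hr : r ≤ (pointwiseSeries K p).radius :=
    hp.r_le.trans (radius_le_radius_pointwiseSeries p)
  have hsum := ((pointwiseSeries K p).hasFPowerSeriesOnBall (hp.r_pos.trans_le hr)).hasSum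
    (y := γ) (by simpa using hγ.trans_le hr)
  have hγs : ‖γ s‖ₑ ≤ ‖γ‖ₑ := by
    simpa only [enorm_le_iff_norm_le] using γ.norm_coe_le_norm s
  have hsum_apply := hsum.map (ContinuousMap.evalCLM 𝕜 s) (ContinuousMap.evalCLM 𝕜 s).continuous
  rw [zero_add] at hsum_apply
  exact hsum_apply.unique (hp.hasSum (by simpa using hγs.trans_lt hγ))

theorem exists_analyticAt_superposition [CompleteSpace F] {V : E → F} {x : E}
    (hV : AnalyticAt 𝕜 V x) :
    ∃ N : C(K, E) → C(K, F), AnalyticAt 𝕜 N (ContinuousMap.const K x) ∧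
      ∀ᶠ γ in 𝓝 (ContinuousMap.const K x), ∀ s, N γ s = V (γ s) := by
  obtain ⟨p, r, hp⟩ := hV
  have hradius : 0 < (pointwiseSeries K p).radius :=
    (hp.r_pos.trans_le hp.r_le).trans_le (radius_le_radius_pointwiseSeries p)
  have hN := ((pointwiseSeries K p).hasFPowerSeriesOnBall hradius).comp_sub
    (ContinuousMap.const K x)
  rw [zero_add] at hN
  refine ⟨_, hN.analyticAt, ?_⟩
  filter_upwards [Metric.eball_mem_nhds (ContinuousMap.const K x) hp.r_pos] with γ hγ s
  rw [pointwiseSeries_sum_apply hp (by rwa [← edist_eq_enorm_sub])]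
  simp

end Superposition

section LocalFlow

variable {E : Type*} [NormedAddCommGroup E] [NormedSpace ℝ E] {a b : ℝ}

variable (E) in
/-- The primitive that vanishes at `t₀`, as a continuous linear map on `C([a, b], E)`. -/
noncomputable def primitiveCLM (t₀ : Set.Icc a b) :
    C(Set.Icc a b, E) →L[ℝ] C(Set.Icc a b, E) :=
  have hab : a ≤ b := t₀.2.1.trans t₀.2.2
  have intervalIntegrable (γ : C(Set.Icc a b, E)) (u v : ℝ) :
      IntervalIntegrable (Set.IccExtend hab γ) volume u v :=
    γ.continuous.Icc_extend'.intervalIntegrable u v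
  LinearMap.mkContinuous
    { toFun := fun γ ↦ ⟨fun s ↦ ∫ u in t₀..s, Set.IccExtend hab γ u,
        (intervalIntegral.continuous_primitive (intervalIntegrable γ) t₀).comp
          continuous_subtype_val⟩
      map_add' := fun γ η ↦ ContinuousMap.ext fun s ↦
        intervalIntegral.integral_add (intervalIntegrable γ t₀ s) (intervalIntegrable η t₀ s)
      map_smul' := fun c γ ↦ ContinuousMap.ext fun s ↦
        intervalIntegral.integral_smul c (Set.IccExtend hab γ) }
    (b - a) fun γ ↦ (ContinuousMap.norm_le _ (by have := sub_nonneg.2 hab; positivity)).2 fun s ↦ by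
      have hst : |(s : ℝ) - t₀| ≤ b - a := by
        rw [abs_le]
        constructor <;> linarith [s.2.1, s.2.2, t₀.2.1, t₀.2.2]
      calc ‖∫ u in t₀..s, Set.IccExtend hab γ u‖ ≤ ‖γ‖ * |(s : ℝ) - t₀| :=
            intervalIntegral.norm_integral_le_of_norm_le_const fun u _ ↦ γ.norm_coe_le_norm _
        _ ≤ (b - a) * ‖γ‖ := by rw [mul_comm]; gcongr

/-- The defect of `γ` as a solution of the integral equation `γ = x + t • ∫ N γ`, as a function
of `((t, x), γ)`. If `N` is the superposition operator of `V`, its zeros are the integral curves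
of `t • V` that start at `x` at time `t₀`. -/
noncomputable def picardDefect (t₀ : Set.Icc a b) (N : C(Set.Icc a b, E) → C(Set.Icc a b, E))
    (p : (ℝ × E) × C(Set.Icc a b, E)) : C(Set.Icc a b, E) :=
  p.2 - ContinuousLinearMap.const ℝ (Set.Icc a b) p.1.2 - p.1.1 • primitiveCLM E t₀ (N p.2)

variable {t₀ : Set.Icc a b} {N : C(Set.Icc a b, E) → C(Set.Icc a b, E)}

lemma contDiffAt_picardDefect {n : WithTop ℕ∞} {p : (ℝ × E) × C(Set.Icc a b, E)}
    (hN : ContDiffAt ℝ n N p.2) : ContDiffAt ℝ n (picardDefect t₀ N) p := by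
  have hprimitive : ContDiffAt ℝ n (fun q : (ℝ × E) × C(Set.Icc a b, E) ↦
      primitiveCLM E t₀ (N q.2)) p :=
    (primitiveCLM E t₀).contDiff.contDiffAt.comp p (hN.comp p contDiffAt_snd)
  have hconst : ContDiffAt ℝ n (fun q : (ℝ × E) × C(Set.Icc a b, E) ↦
      ContinuousLinearMap.const ℝ (Set.Icc a b) q.1.2) p :=
    (ContinuousLinearMap.const ℝ (Set.Icc a b)).contDiff.contDiffAt.comp p contDiffAt_fst.snd
  exact (contDiffAt_snd.sub hconst).sub (contDiffAt_fst.fst.smul hprimitive)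

lemma fderiv_picardDefect_comp_inr {x : E} {γ : C(Set.Icc a b, E)}
    (hN : DifferentiableAt ℝ (picardDefect t₀ N) ((0, x), γ)) :
    fderiv ℝ (picardDefect t₀ N) ((0, x), γ) ∘L .inr ℝ (ℝ × E) C(Set.Icc a b, E) =
      .id ℝ C(Set.Icc a b, E) := by
  have hpartial := hN.hasFDerivAt.comp γ (hasFDerivAt_prodMk_right (0, x) γ)
  have hid : picardDefect t₀ N ∘ (fun η ↦ ((0, x), η)) =
      fun η ↦ η - ContinuousLinearMap.const ℝ (Set.Icc a b) x := by
    ext η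
    simp [picardDefect]
  rw [hid] at hpartial
  exact hpartial.unique ((hasFDerivAt_id γ).sub_const _)

lemma exists_contDiffAt_picardDefect_eq_zero [CompleteSpace E] {n : WithTop ℕ∞} (hn : n ≠ 0) {x : E}
    (hN : ContDiffAt ℝ n N (ContinuousMap.const _ x)) :
    ∃ ψ : ℝ × E → C(Set.Icc a b, E), ContDiffAt ℝ n ψ (0, x) ∧
      ψ (0, x) = ContinuousMap.const _ x ∧ ∀ᶠ q in 𝓝 (0, x), picardDefect t₀ N (q, ψ q) = 0 := by
  have hdefect : ContDiffAt ℝ n (picardDefect t₀ N) ((0, x), ContinuousMap.const _ x) :=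
    contDiffAt_picardDefect hN
  have hinvertible : (fderiv ℝ (picardDefect t₀ N) ((0, x), ContinuousMap.const _ x) ∘L
      .inr ℝ (ℝ × E) C(Set.Icc a b, E)).IsInvertible := by
    rw [fderiv_picardDefect_comp_inr (hdefect.differentiableAt hn)]
    exact ContinuousLinearMap.isInvertible_equiv (f := ContinuousLinearEquiv.refl ℝ _)
  have hzero : picardDefect t₀ N ((0, x), ContinuousMap.const _ x) = 0 := by
    ext s
    simp [picardDefect]
  refine ⟨hdefect.implicitFunction hn hinvertible,
    hdefect.contDiffAt_implicitFunction hn hinvertible,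
    hdefect.implicitFunction_apply_self hn hinvertible, ?_⟩
  simpa only [hzero] using hdefect.eventually_apply_implicitFunction hn hinvertible

lemma eq_add_of_picardDefect_eq_zero {t : ℝ} {x : E} {γ : C(Set.Icc a b, E)}
    (hγ : picardDefect t₀ N ((t, x), γ) = 0) (s : Set.Icc a b) :
    γ s = x + t • ∫ u in t₀..s, Set.IccExtend (t₀.2.1.trans t₀.2.2) (N γ) u := by
  have hdefect := congrArg (fun η : C(Set.Icc a b, E) ↦ η s) hγ
  simp only [picardDefect, ContinuousMap.sub_apply, ContinuousMap.zero_apply, sub_sub] at hdefect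
  exact sub_eq_zero.1 hdefect

lemma hasDerivAt_of_picardDefect_eq_zero [CompleteSpace E] {t : ℝ} {x : E} {γ : C(Set.Icc a b, E)}
    (hγ : picardDefect t₀ N ((t, x), γ) = 0) {s : Set.Icc a b} (hs : (s : ℝ) ∈ Set.Ioo a b) :
    HasDerivAt (Set.IccExtend (t₀.2.1.trans t₀.2.2) γ) (t • N γ s) s := by
  have hab : a ≤ b := t₀.2.1.trans t₀.2.2
  have hcont : Continuous (Set.IccExtend hab (N γ)) := (N γ).continuous.Icc_extend'
  have hprimitive : HasDerivAt (fun r ↦ ∫ u in t₀..r, Set.IccExtend hab (N γ) u) (N γ s) s := by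
    simpa only [Set.IccExtend_val] using
      intervalIntegral.integral_hasDerivAt_right (hcont.intervalIntegrable t₀ s)
        hcont.stronglyMeasurable.stronglyMeasurableAtFilter hcont.continuousAt
  refine ((hprimitive.const_smul t).const_add x).congr_of_eventuallyEq ?_
  filter_upwards [isOpen_Ioo.mem_nhds hs] with r hr
  rw [Set.IccExtend_of_mem hab γ (Set.Ioo_subset_Icc_self hr)]
  exact eq_add_of_picardDefect_eq_zero hγ _

theorem exists_analytic_local_flow [CompleteSpace E] {V : E → E} {x : E} (hV : AnalyticAt ℝ V x)
    {U : Set E} (hU : U ∈ 𝓝 x) :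
    ∃ φ : ℝ × E → E, ContDiffAt ℝ ω φ (0, x) ∧ ∀ᶠ q in 𝓝 ((0 : ℝ), x),
      ∃ c : ℝ → E, c 0 = q.2 ∧ c 1 = φ q ∧
        ∀ s ∈ Set.Ioo (-2 : ℝ) 2, c s ∈ U ∧ HasDerivAt c (q.1 • V (c s)) s := by
  have hle : (-2 : ℝ) ≤ 2 := by norm_num
  let zero : Set.Icc (-2 : ℝ) 2 := ⟨0, by norm_num⟩
  let one : Set.Icc (-2 : ℝ) 2 := ⟨1, by norm_num⟩
  obtain ⟨N, hN, hNV⟩ := exists_analyticAt_superposition (K := Set.Icc (-2 : ℝ) 2) hV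
  obtain ⟨ψ, hψ, hψ_self, hψ_zero⟩ :=
    exists_contDiffAt_picardDefect_eq_zero (t₀ := zero) (n := ω) (by simp) hN.contDiffAt
  have hψ_tendsto : Filter.Tendsto ψ (𝓝 (0, x)) (𝓝 (ContinuousMap.const _ x)) := by
    simpa only [ContinuousAt, hψ_self] using hψ.continuousAt
  have hmem : ∀ᶠ γ in 𝓝 (ContinuousMap.const (Set.Icc (-2 : ℝ) 2) x), ∀ s, γ s ∈ U := by
    obtain ⟨r, hr, hrU⟩ := Metric.mem_nhds_iff.1 hU
    filter_upwards [Metric.ball_mem_nhds _ hr] with γ hγ s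
    exact hrU ((ContinuousMap.dist_apply_le_dist s).trans_lt hγ)
  refine ⟨ContinuousMap.evalCLM ℝ one ∘ ψ,
    (ContinuousMap.evalCLM ℝ one).contDiff.contDiffAt.comp _ hψ, ?_⟩
  filter_upwards [hψ_zero, hψ_tendsto.eventually hNV, hψ_tendsto.eventually hmem]
    with q hq hNq hUq
  refine ⟨Set.IccExtend hle (ψ q), ?_, Set.IccExtend_val hle (ψ q) one, fun s hs ↦ ?_⟩
  · rw [Set.IccExtend_val hle (ψ q) zero, eq_add_of_picardDefect_eq_zero hq]
    simp
  · rw [Set.IccExtend_of_mem hle _ (Set.Ioo_subset_Icc_self hs)]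
    refine ⟨hUq _, ?_⟩
    rw [← hNq]
    exact hasDerivAt_of_picardDefect_eq_zero hq (s := ⟨s, Set.Ioo_subset_Icc_self hs⟩) hs

end LocalFlow

section ChartField

variable {d : ℕ} {M : Type*} [TopologicalSpace M] [ChartedSpace (EuclideanSpace ℝ (Fin d)) M]

/-- The coordinate expression of a vector field in the chart at `x₀`. -/
noncomputable def chartField (x₀ : M) (V : VectorFieldOn d M) :
    EuclideanSpace ℝ (Fin d) → EuclideanSpace ℝ (Fin d) :=
  VectorField.mpullback 𝓘(ℝ, EuclideanSpace ℝ (Fin d)) (𝓡 d) (extChartAt (𝓡 d) x₀).symm V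

lemma chartField_add (x₀ : M) (V W : VectorFieldOn d M) :
    chartField x₀ (V + W) = chartField x₀ V + chartField x₀ W :=
  VectorField.mpullback_add

lemma chartField_smul (x₀ : M) (c : ℝ) (V : VectorFieldOn d M) :
    chartField x₀ (c • V) = c • chartField x₀ V :=
  VectorField.mpullback_const_smul

lemma chartField_zero (x₀ : M) : chartField x₀ (0 : VectorFieldOn d M) = 0 := by
  simpa using chartField_smul x₀ (0 : ℝ) (0 : VectorFieldOn d M)

lemma chartField_sum_smul {ι : Type*} (x₀ : M) (s : Finset ι) (c : ι → ℝ)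
    (V : ι → VectorFieldOn d M) :
    chartField x₀ (∑ j ∈ s, c j • V j) = ∑ j ∈ s, c j • chartField x₀ (V j) := by
  let L : VectorFieldOn d M →ₗ[ℝ] EuclideanSpace ℝ (Fin d) → EuclideanSpace ℝ (Fin d) :=
    { toFun := chartField x₀
      map_add' := chartField_add x₀
      map_smul' := chartField_smul x₀ }
  change L _ = ∑ j ∈ s, c j • L (V j)
  simp only [map_sum, map_smul]

section

variable [IsManifold (𝓡 d) 1 M] {x₀ : M} {y : EuclideanSpace ℝ (Fin d)}

lemma isInvertible_mfderiv_extChartAt_symm (hy : y ∈ (extChartAt (𝓡 d) x₀).target) :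
    (mfderiv 𝓘(ℝ, EuclideanSpace ℝ (Fin d)) (𝓡 d) (extChartAt (𝓡 d) x₀).symm y).IsInvertible := by
  simpa only [ModelWithCorners.range_eq_univ, mfderivWithin_univ] using
    isInvertible_mfderivWithin_extChartAt_symm (I := 𝓡 d) hy

lemma mfderiv_extChartAt_symm_chartField (hy : y ∈ (extChartAt (𝓡 d) x₀).target)
    (V : VectorFieldOn d M) :
    mfderiv 𝓘(ℝ, EuclideanSpace ℝ (Fin d)) (𝓡 d) (extChartAt (𝓡 d) x₀).symm y
      (chartField x₀ V y) = V ((extChartAt (𝓡 d) x₀).symm y) :=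
  (isInvertible_mfderiv_extChartAt_symm hy).self_apply_inverse _

end

lemma contMDiffAt_extChartAt_symm_target {n : WithTop ℕ∞} [IsManifold (𝓡 d) n M] {x₀ : M}
    {y : EuclideanSpace ℝ (Fin d)} (hy : y ∈ (extChartAt (𝓡 d) x₀).target) :
    ContMDiffAt 𝓘(ℝ, EuclideanSpace ℝ (Fin d)) (𝓡 d) n (extChartAt (𝓡 d) x₀).symm y :=
  (contMDiffOn_extChartAt_symm x₀).contMDiffAt ((isOpen_extChartAt_target x₀).mem_nhds hy)

variable [IsManifold (𝓡 d) ω M]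

lemma contDiffAt_chartField {n : WithTop ℕ∞} {x₀ : M} {y : EuclideanSpace ℝ (Fin d)}
    (hy : y ∈ (extChartAt (𝓡 d) x₀).target) {V : VectorFieldOn d M}
    (hV : ContMDiffAt (𝓡 d) (𝓡 d).tangent n
      (fun x : M ↦ (⟨x, V x⟩ : TangentBundle (𝓡 d) M)) ((extChartAt (𝓡 d) x₀).symm y)) :
    ContDiffAt ℝ n (chartField x₀ V) y :=
  contMDiffAt_vectorSpace_iff_contDiffAt.1
    (ContMDiffAt.mpullback_vectorField_preimage (n := ω) hV (contMDiffAt_extChartAt_symm_target hy)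
      (isInvertible_mfderiv_extChartAt_symm hy) le_top)

lemma chartField_mlieBracket {x₀ : M} {y : EuclideanSpace ℝ (Fin d)}
    (hy : y ∈ (extChartAt (𝓡 d) x₀).target) {V W : VectorFieldOn d M}
    (hV : MDifferentiableAt (𝓡 d) (𝓡 d).tangent
      (fun x : M ↦ (⟨x, V x⟩ : TangentBundle (𝓡 d) M)) ((extChartAt (𝓡 d) x₀).symm y))
    (hW : MDifferentiableAt (𝓡 d) (𝓡 d).tangent
      (fun x : M ↦ (⟨x, W x⟩ : TangentBundle (𝓡 d) M)) ((extChartAt (𝓡 d) x₀).symm y)) :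
    chartField x₀ (VectorField.mlieBracket (𝓡 d) V W) y =
      VectorField.lieBracket ℝ (chartField x₀ V) (chartField x₀ W) y := by
  have : IsManifold (𝓡 d) (minSmoothness ℝ 2) M := IsManifold.of_le (n := ω) le_top
  have : IsManifold (𝓡 d) (minSmoothness ℝ 3) M := IsManifold.of_le (n := ω) le_top
  have hpullback := VectorField.mpullback_mlieBracket (n := ω) (I := 𝓘(ℝ, EuclideanSpace ℝ (Fin d)))
    (I' := 𝓡 d) hV hW (contMDiffAt_extChartAt_symm_target hy) le_top
  refine hpullback.trans ?_
  rw [← VectorField.mlieBracketWithin_univ, VectorField.mlieBracketWithin_eq_lieBracketWithin]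
  exact congrFun (VectorField.lieBracketWithin_univ (V := chartField x₀ V)) y

end ChartField

section Flow

variable {d : ℕ} {M : Type*} [TopologicalSpace M] [ChartedSpace (EuclideanSpace ℝ (Fin d)) M]
  {V : VectorFieldOn d M}

lemma IsCompleteVectorField.vectorFlow_zero (hc : IsCompleteVectorField V) (x : M) :
    vectorFlow V 0 x = x := by
  rw [vectorFlow, dif_pos (hc x)]
  exact (hc x).choose_spec.1

lemma IsCompleteVectorField.isMIntegralCurve_vectorFlow (hc : IsCompleteVectorField V) (x : M) :
    IsMIntegralCurve (I := 𝓡 d) (fun t ↦ vectorFlow V t x) V := by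
  have hflow : (fun t ↦ vectorFlow V t x) = (hc x).choose := by
    ext t
    rw [vectorFlow, dif_pos (hc x)]
  rw [hflow]
  exact (hc x).choose_spec.2

lemma isMIntegralCurveOn_extChartAt_symm_comp [IsManifold (𝓡 d) 1 M] {x₀ : M}
    {c : ℝ → EuclideanSpace ℝ (Fin d)} {t : ℝ} {S : Set ℝ}
    (hc : ∀ s ∈ S, c s ∈ (extChartAt (𝓡 d) x₀).target ∧
      HasDerivAt c (t • chartField x₀ V (c s)) s) :
    IsMIntegralCurveOn (I := 𝓡 d) ((extChartAt (𝓡 d) x₀).symm ∘ c) (t • V) S := fun s hs ↦ by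
  obtain ⟨hcs, hderiv⟩ := hc s hs
  have hcomp := ((contMDiffAt_extChartAt_symm_target (n := 1) hcs).mdifferentiableAt
    one_ne_zero).hasMFDerivAt.comp s hderiv.hasFDerivAt.hasMFDerivAt
  refine HasMFDerivAt.hasMFDerivWithinAt ?_
  refine hcomp.congr_mfderiv (ContinuousLinearMap.ext_ring ?_)
  change mfderiv 𝓘(ℝ, EuclideanSpace ℝ (Fin d)) (𝓡 d) (extChartAt (𝓡 d) x₀).symm (c s)
    ((1 : ℝ) • t • chartField x₀ V (c s)) = (1 : ℝ) • t • V ((extChartAt (𝓡 d) x₀).symm (c s))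
  rw [one_smul, one_smul, ← mfderiv_extChartAt_symm_chartField hcs V]
  exact ContinuousLinearMap.map_smul _ t _

variable [IsManifold (𝓡 d) ω M]

lemma IsAnalyticVectorField.const_smul (hV : IsAnalyticVectorField V) (c : ℝ) :
    IsAnalyticVectorField (c • V) :=
  ContMDiff.const_smul_section (n := ω) hV

variable [T2Space M]

lemma IsCompleteVectorField.eqOn_vectorFlow_mul (hc : IsCompleteVectorField V)
    (hV : IsAnalyticVectorField V) {γ : ℝ → M} {t a b : ℝ} (h0 : (0 : ℝ) ∈ Set.Ioo a b)
    (hγ : IsMIntegralCurveOn (I := 𝓡 d) γ (t • V) (Set.Ioo a b)) :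
    Set.EqOn γ (fun s ↦ vectorFlow V (s * t) (γ 0)) (Set.Ioo a b) := by
  refine isMIntegralCurveOn_Ioo_eqOn_of_contMDiff_boundaryless h0
    (ContMDiff.of_le (hV.const_smul t) le_top) hγ
    (((hc.isMIntegralCurve_vectorFlow (γ 0)).comp_mul t).isMIntegralCurveOn _) ?_
  simp [hc.vectorFlow_zero]

lemma IsCompleteVectorField.vectorFlow_add (hc : IsCompleteVectorField V)
    (hV : IsAnalyticVectorField V) (s t : ℝ) (x : M) :
    vectorFlow V (s + t) x = vectorFlow V s (vectorFlow V t x) :=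
  congrFun (isMIntegralCurve_Ioo_eq_of_contMDiff_boundaryless (t₀ := 0) (ContMDiff.of_le hV le_top)
    ((hc.isMIntegralCurve_vectorFlow x).comp_add t)
    (hc.isMIntegralCurve_vectorFlow (vectorFlow V t x)) (by simp [hc.vectorFlow_zero])) s

lemma IsCompleteVectorField.exists_analytic_chart_expression (hc : IsCompleteVectorField V)
    (hV : IsAnalyticVectorField V) (x₀ : M) :
    ∃ φ : ℝ × EuclideanSpace ℝ (Fin d) → EuclideanSpace ℝ (Fin d),
      ContDiffAt ℝ ω φ (0, extChartAt (𝓡 d) x₀ x₀) ∧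
      φ (0, extChartAt (𝓡 d) x₀ x₀) ∈ (extChartAt (𝓡 d) x₀).target ∧
      ∀ᶠ p in 𝓝 ((0 : ℝ), x₀), vectorFlow V p.1 p.2 =
        (extChartAt (𝓡 d) x₀).symm (φ (p.1, extChartAt (𝓡 d) x₀ p.2)) := by
  have hx : extChartAt (𝓡 d) x₀ x₀ ∈ (extChartAt (𝓡 d) x₀).target := mem_extChartAt_target x₀
  obtain ⟨φ, hφ, hcurve⟩ := exists_analytic_local_flow (contDiffAt_chartField hx (hV _)).analyticAt
    ((isOpen_extChartAt_target x₀).mem_nhds hx)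
  have hone : (1 : ℝ) ∈ Set.Ioo (-2 : ℝ) 2 := by norm_num
  have hchart : ContinuousAt (fun p : ℝ × M ↦ (p.1, extChartAt (𝓡 d) x₀ p.2)) (0, x₀) :=
    continuousAt_fst.prodMk (ContinuousAt.comp (f := Prod.snd) (continuousAt_extChartAt x₀)
      continuousAt_snd)
  refine ⟨φ, hφ, ?_, ?_⟩
  · obtain ⟨c, -, hc1, hcs⟩ := hcurve.self_of_nhds
    exact hc1 ▸ (hcs 1 hone).1
  · filter_upwards [hchart.eventually hcurve,
      continuousAt_snd.eventually (extChartAt_source_mem_nhds (I := 𝓡 d) x₀)]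
      with p ⟨c, hc0, hc1, hcs⟩ hp
    have hflow := hc.eqOn_vectorFlow_mul hV (by norm_num)
      (isMIntegralCurveOn_extChartAt_symm_comp hcs) hone
    simpa only [Function.comp_apply, hc1, hc0, one_mul,
      (extChartAt (𝓡 d) x₀).left_inv hp] using hflow.symm

lemma IsCompleteVectorField.contMDiffAt_vectorFlow_zero (hc : IsCompleteVectorField V)
    (hV : IsAnalyticVectorField V) (x₀ : M) :
    ContMDiffAt (𝓘(ℝ, ℝ).prod (𝓡 d)) (𝓡 d) ω (fun p : ℝ × M ↦ vectorFlow V p.1 p.2) (0, x₀) := by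
  obtain ⟨φ, hφ, hφ_mem, hflow⟩ := hc.exists_analytic_chart_expression hV x₀
  have hchart : ContMDiffAt (𝓘(ℝ, ℝ).prod (𝓡 d)) (𝓘(ℝ, ℝ).prod 𝓘(ℝ, EuclideanSpace ℝ (Fin d))) ω
      (fun p : ℝ × M ↦ (p.1, extChartAt (𝓡 d) x₀ p.2)) (0, x₀) :=
    contMDiffAt_fst.prodMk (contMDiffAt_extChartAt.comp (0, x₀) contMDiffAt_snd)
  have hφ' : ContMDiffAt (𝓘(ℝ, ℝ).prod 𝓘(ℝ, EuclideanSpace ℝ (Fin d)))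
      𝓘(ℝ, EuclideanSpace ℝ (Fin d)) ω φ (0, extChartAt (𝓡 d) x₀ x₀) := by
    rw [← modelWithCornersSelf_prod, chartedSpaceSelf_prod]
    exact hφ.contMDiffAt
  exact ((contMDiffAt_extChartAt_symm_target hφ_mem).comp (0, x₀)
    (hφ'.comp (0, x₀) hchart)).congr_of_eventuallyEq hflow

lemma IsCompleteVectorField.contMDiffAt_vectorFlow_trans (hc : IsCompleteVectorField V)
    (hV : IsAnalyticVectorField V) {s t : ℝ} {x : M}
    (hs : ContMDiffAt (𝓘(ℝ, ℝ).prod (𝓡 d)) (𝓡 d) ω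
      (fun p : ℝ × M ↦ vectorFlow V p.1 p.2) (s, x))
    (ht : ContMDiffAt (𝓘(ℝ, ℝ).prod (𝓡 d)) (𝓡 d) ω
      (fun p : ℝ × M ↦ vectorFlow V p.1 p.2) (t - s, vectorFlow V s x)) :
    ContMDiffAt (𝓘(ℝ, ℝ).prod (𝓡 d)) (𝓡 d) ω (fun p : ℝ × M ↦ vectorFlow V p.1 p.2) (t, x) := by
  have hsplit : (fun p : ℝ × M ↦ vectorFlow V p.1 p.2) =
      (fun p : ℝ × M ↦ vectorFlow V p.1 p.2) ∘
        fun p : ℝ × M ↦ (p.1 - s, vectorFlow V s p.2) := by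
    ext p
    simp [← hc.vectorFlow_add hV]
  have hfreeze : ContMDiffAt (𝓘(ℝ, ℝ).prod (𝓡 d)) (𝓘(ℝ, ℝ).prod (𝓡 d)) ω
      (fun p : ℝ × M ↦ (s, p.2)) (t, x) := contMDiffAt_const.prodMk contMDiffAt_snd
  rw [hsplit]
  exact ContMDiffAt.comp (t, x) ht ((contMDiffAt_fst.sub contMDiffAt_const).prodMk
    (ContMDiffAt.comp (g := fun p : ℝ × M ↦ vectorFlow V p.1 p.2) (t, x) hs hfreeze))

theorem IsCompleteVectorField.contMDiff_vectorFlow (hc : IsCompleteVectorField V)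
    (hV : IsAnalyticVectorField V) :
    ContMDiff (𝓘(ℝ, ℝ).prod (𝓡 d)) (𝓡 d) ω (fun p : ℝ × M ↦ vectorFlow V p.1 p.2) := by
  rintro ⟨t, x⟩
  refine (isPreconnected_univ.induction₂ (fun s r : ℝ ↦
    ContMDiffAt (𝓘(ℝ, ℝ).prod (𝓡 d)) (𝓡 d) ω (fun p : ℝ × M ↦ vectorFlow V p.1 p.2) (s, x) ↔
    ContMDiffAt (𝓘(ℝ, ℝ).prod (𝓡 d)) (𝓡 d) ω (fun p : ℝ × M ↦ vectorFlow V p.1 p.2) (r, x))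
    (fun s _ ↦ ?_) (fun _ _ _ _ _ _ ↦ Iff.trans) (fun _ _ _ _ ↦ Iff.symm)
    (Set.mem_univ 0) (Set.mem_univ t)).1
    (hc.contMDiffAt_vectorFlow_zero hV x)
  rw [nhdsWithin_univ]
  have hnear := (contMDiffAt_iff_contMDiffAt_nhds (n := ω) (by simp)).1
    (hc.contMDiffAt_vectorFlow_zero hV (vectorFlow V s x))
  have hflow := (hc.isMIntegralCurve_vectorFlow x).continuous
  have hforward : Filter.Tendsto (fun r ↦ (r - s, vectorFlow V s x)) (𝓝 s)
      (𝓝 (0, vectorFlow V s x)) :=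
    Continuous.tendsto' (by fun_prop) _ _ (by simp)
  have hbackward : Filter.Tendsto (fun r ↦ (s - r, vectorFlow V r x)) (𝓝 s)
      (𝓝 (0, vectorFlow V s x)) :=
    Continuous.tendsto' (by fun_prop) _ _ (by simp)
  filter_upwards [hforward.eventually hnear, hbackward.eventually hnear] with r hforward hbackward
  exact ⟨fun hs ↦ hc.contMDiffAt_vectorFlow_trans hV hs hforward,
    fun hr ↦ hc.contMDiffAt_vectorFlow_trans hV hr hbackward⟩

end Flow

/-! ### Submersions and absolutely continuous measures -/

section Surjectivity

lemma isOpen_setOf_surjective_clm {𝕜 E F : Type*} [NontriviallyNormedField 𝕜] [CompleteSpace 𝕜]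
    [NormedAddCommGroup E] [NormedSpace 𝕜 E] [NormedAddCommGroup F] [NormedSpace 𝕜 F]
    [FiniteDimensional 𝕜 F] : IsOpen {A : E →L[𝕜] F | Function.Surjective A} := by
  refine isOpen_iff_mem_nhds.2 fun A hA ↦ ?_
  obtain ⟨R, hR⟩ := A.exists_rightInverse_of_surjective (LinearMap.range_eq_top.2 hA)
  have : CompleteSpace F := FiniteDimensional.complete 𝕜 F
  have hcomp : ContinuousAt (fun B : E →L[𝕜] F ↦ B ∘L R) A :=
    continuousAt_id.clm_comp continuousAt_const
  have hunits : {B : F →L[𝕜] F | IsUnit B} ∈ 𝓝 (A ∘L R) :=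
    Units.isOpen.mem_nhds (by rw [hR]; exact isUnit_one)
  filter_upwards [hcomp hunits] with B hB
  exact (ContinuousLinearMap.isUnit_iff_bijective.1 hB).surjective.of_comp (g := R)

lemma analyticAt_clm_det {𝕜 F : Type*} [NontriviallyNormedField 𝕜] [CompleteSpace 𝕜]
    [NormedAddCommGroup F] [NormedSpace 𝕜 F] [FiniteDimensional 𝕜 F] (A : F →L[𝕜] F) :
    AnalyticAt 𝕜 (fun B : F →L[𝕜] F ↦ B.det) A := by
  let b := Module.finBasis 𝕜 F
  let entry (i j : Fin (Module.finrank 𝕜 F)) : (F →L[𝕜] F) →L[𝕜] 𝕜 :=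
    (b.coord i).toContinuousLinearMap ∘L ContinuousLinearMap.apply 𝕜 F (b j)
  have hdet (B : F →L[𝕜] F) :
      B.det = ∑ σ : Equiv.Perm (Fin (Module.finrank 𝕜 F)), σ.sign * ∏ j, entry (σ j) j B := by
    rw [ContinuousLinearMap.det, ← LinearMap.det_toMatrix b, Matrix.det_apply']
    simp [entry, LinearMap.toMatrix_apply]
  simp only [hdet]
  exact Finset.analyticAt_fun_sum _ fun σ _ ↦ analyticAt_const.fun_mul
    (Finset.analyticAt_fun_prod _ fun j _ ↦ (entry (σ j) j).analyticAt A)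

lemma eventually_surjective_of_analyticAt_of_frequently {E F : Type*} [NormedAddCommGroup E]
    [NormedSpace ℝ E] [NormedAddCommGroup F] [NormedSpace ℝ F] [FiniteDimensional ℝ F]
    {J : ℝ → E →L[ℝ] F} {s₀ : ℝ} (hJ : AnalyticAt ℝ J s₀)
    (hsurj : ∃ᶠ s in 𝓝 s₀, Function.Surjective (J s)) :
    ∀ᶠ s in 𝓝[≠] s₀, Function.Surjective (J s) := by
  obtain ⟨ε, hε, hball⟩ := Metric.eventually_nhds_iff_ball.1 hJ.eventually_analyticAt
  obtain ⟨s₁, hs₁, hs₁_mem⟩ := (hsurj.and_eventually (Metric.ball_mem_nhds s₀ hε)).exists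
  obtain ⟨R, hR⟩ := (J s₁).exists_rightInverse_of_surjective (LinearMap.range_eq_top.2 hs₁)
  have hdet : AnalyticOnNhd ℝ (fun s ↦ (J s ∘L R).det) (Metric.ball s₀ ε) := fun s hs ↦
    (analyticAt_clm_det _).comp (f := fun s ↦ J s ∘L R)
      ((((ContinuousLinearMap.compL ℝ F E F).flip R).analyticAt (J s)).comp (hball s hs))
  rcases (hdet s₀ (Metric.mem_ball_self hε)).eventually_eq_zero_or_eventually_ne_zero
    with hzero | hne
  · have hs₁_zero := hdet.eqOn_zero_of_preconnected_of_eventuallyEq_zero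
      (convex_ball s₀ ε).isPreconnected (Metric.mem_ball_self hε) hzero hs₁_mem
    simp [hR, ContinuousLinearMap.det] at hs₁_zero
  · filter_upwards [hne] with s hs
    have hunit : IsUnit (J s ∘L R : F →ₗ[ℝ] F) :=
      (LinearMap.isUnit_iff_isUnit_det _).2 (isUnit_iff_ne_zero.2 hs)
    exact ((Module.End.isUnit_iff _).1 hunit).surjective.of_comp (g := R)

end Surjectivity

section NullSets

lemma ae_of_frequently_imp_eventually_nhdsNE {X : Type*} [TopologicalSpace X] [PreconnectedSpace X]
    [SecondCountableTopology X] [MeasurableSpace X] {μ : Measure X} [NullSingletonClass μ]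
    {P : X → Prop} {x₁ : X} (hx₁ : P x₁) (hP : ∀ x₀, (∃ᶠ x in 𝓝 x₀, P x) → ∀ᶠ x in 𝓝[≠] x₀, P x) :
    ∀ᵐ x ∂μ, P x := by
  have hclopen : IsClopen (closure {x | P x}) := by
    refine ⟨isClosed_closure, isOpen_iff_mem_nhds.2 fun x₀ hx₀ ↦ ?_⟩
    filter_upwards [eventually_nhdsWithin_iff.1 (hP x₀ (mem_closure_iff_frequently.1 hx₀))]
      with x hx
    rcases eq_or_ne x x₀ with rfl | hne
    · exact hx₀
    · exact subset_closure (hx hne)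
  have hdense : closure {x | P x} = Set.univ := hclopen.eq_univ ⟨x₁, subset_closure hx₁⟩
  refine measure_null_of_locally_null _ fun x₀ _ ↦ ⟨{x₀}, ?_, measure_singleton x₀⟩
  have hx₀ : x₀ ∈ closure {x | P x} := hdense ▸ Set.mem_univ x₀
  rw [mem_nhdsWithin_iff_eventually]
  filter_upwards [eventually_nhdsWithin_iff.1 (hP x₀ (mem_closure_iff_frequently.1 hx₀))]
    with x hx hxP
  by_contra hne
  exact hxP (hx hne)

lemma ae_of_forall_ae_line {E : Type*} [NormedAddCommGroup E] [NormedSpace ℝ E]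
    [FiniteDimensional ℝ E] [MeasurableSpace E] [BorelSpace E] (μ : Measure E)
    [μ.IsAddHaarMeasure] {P : E → Prop} (hP : MeasurableSet {q | P q}) (p : E)
    (hline : ∀ v : E, ∀ᵐ s : ℝ, P (p + s • v)) : ∀ᵐ q ∂μ, P q := by
  have hmeas : MeasurableSet {q : E × ℝ | P (p + q.2 • q.1)} := by
    have haffine : Measurable fun q : E × ℝ ↦ p + q.2 • q.1 := by fun_prop
    exact haffine hP
  have hswap : ∀ᵐ s : ℝ, ∀ᵐ v ∂μ, P (p + s • v) :=
    (Measure.ae_ae_comm hmeas).1 (Filter.Eventually.of_forall hline)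
  obtain ⟨s, hs, hs_ne⟩ := (hswap.and (Measure.ae_ne volume (0 : ℝ))).exists
  rw [ae_iff] at hs ⊢
  change μ ((s • ·) ⁻¹' ((p + ·) ⁻¹' {q | ¬ P q})) = 0 at hs
  rw [Measure.addHaar_preimage_smul μ hs_ne, measure_preimage_add] at hs
  simpa [hs_ne] using hs

end NullSets

section SubmersionDensity

variable {E F Z : Type*} [NormedAddCommGroup E] [NormedSpace ℝ E]
  [MeasurableSpace E] [BorelSpace E] (μ : Measure E) [μ.IsAddHaarMeasure]
  [NormedAddCommGroup F] [NormedSpace ℝ F] [FiniteDimensional ℝ F]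
  [MeasurableSpace F] [BorelSpace F] (lam : Measure F) [lam.IsAddHaarMeasure]
  [NormedAddCommGroup Z] [NormedSpace ℝ Z]

lemma exists_measure_preimage_prod_eq {G : Type*} [NormedAddCommGroup G] [NormedSpace ℝ G]
    [FiniteDimensional ℝ G] [MeasurableSpace G] [BorelSpace G] (κ : Measure G) [κ.IsAddHaarMeasure]
    (A : E ≃L[ℝ] F × G) : ∃ c : NNReal, ∀ X Y, μ (A ⁻¹' (X ×ˢ Y)) = c * (lam X * κ Y) := by
  have : (μ.map A).IsAddHaarMeasure := A.isAddHaarMeasure_map μ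
  refine ⟨Measure.addHaarScalarFactor (μ.map A) (lam.prod κ), fun X Y ↦ ?_⟩
  calc μ (A ⁻¹' (X ×ˢ Y)) = μ.map A (X ×ˢ Y) :=
        (A.toHomeomorph.toMeasurableEquiv.map_apply _).symm
    _ = ((μ.map A).addHaarScalarFactor (lam.prod κ) • lam.prod κ) (X ×ˢ Y) :=
        congrArg (fun m : Measure (F × G) ↦ m (X ×ˢ Y)) (Measure.isAddLeftInvariant_eq_smul _ _)
    _ = (μ.map A).addHaarScalarFactor (lam.prod κ) * (lam X * κ Y) := by
        rw [← Measure.prod_prod]; rfl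

variable [FiniteDimensional ℝ E]

lemma exists_measure_le_two_mul_image {f : E × Z → E} {D : E × Z →L[ℝ] E} {t₀ : E} {z₀ : Z}
    (hf : HasStrictFDerivAt f D (t₀, z₀)) (hD : D ∘L .inl ℝ E Z = .id ℝ E) :
    ∃ U ∈ 𝓝 t₀, ∃ V ∈ 𝓝 z₀, ∀ z ∈ V, ∀ S ⊆ U, μ S ≤ 2 * μ ((fun t ↦ f (t, z)) '' S) := by
  have hdet : ((1 / 2 : NNReal) : ENNReal) < ENNReal.ofReal |(ContinuousLinearMap.id ℝ E).det| := by
    simp [ContinuousLinearMap.det]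
  obtain ⟨δ, hδ, hδ_pos⟩ :=
    ((mul_le_addHaar_image_of_lt_det μ _ hdet).and self_mem_nhdsWithin).exists
  obtain ⟨W, hW, hfW⟩ := hf.approximates_deriv_on_nhds (Or.inr hδ_pos)
  obtain ⟨U, hU, V, hV, hUV⟩ := mem_nhds_prod_iff.1 hW
  refine ⟨U, hU, V, hV, fun z hz S hS ↦ ?_⟩
  have hslice : ApproximatesLinearOn (fun t ↦ f (t, z)) (.id ℝ E) S δ := fun t ht t' ht' ↦ by
    simpa [← hD] using hfW (t, z) (hUV ⟨hS ht, hz⟩) (t', z) (hUV ⟨hS ht', hz⟩)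
  calc μ S = 2 * ((1 / 2 : NNReal) * μ S) := by simp [← mul_assoc, ENNReal.mul_inv_cancel]
    _ ≤ 2 * μ ((fun t ↦ f (t, z)) '' S) := by gcongr; exact hδ S _ hslice

lemma exists_measure_le_mul_image {f : E × Z → F} {D : E × Z →L[ℝ] F} {t₀ : E} {z₀ : Z}
    (hf : HasStrictFDerivAt f D (t₀, z₀)) (hD : Function.Surjective (D ∘L .inl ℝ E Z)) :
    ∃ C : NNReal, ∃ U ∈ 𝓝 t₀, ∃ V ∈ 𝓝 z₀, ∀ z ∈ V, ∀ S ⊆ U,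
      μ S ≤ C * lam ((fun t ↦ f (t, z)) '' S) := by
  let L := D ∘L .inl ℝ E Z
  obtain ⟨P, hP⟩ := Submodule.ClosedComplemented.of_finiteDimensional_quotient (p := L.ker)
    L.isClosed_ker
  let A : E ≃L[ℝ] F × L.ker := L.equivProdOfSurjectiveOfIsCompl P (LinearMap.range_eq_top.2 hD)
    (LinearMap.range_eq_of_proj hP) (LinearMap.isCompl_of_proj hP)
  -- Completing `f (·, z)` by the projection onto the kernel gives local diffeomorphisms.
  let g : E × Z → E := fun q ↦ A.symm (f q, P q.1)
  have hg : HasStrictFDerivAt g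
      (A.symm.toContinuousLinearMap ∘L D.prod (P ∘L .fst ℝ E Z)) (t₀, z₀) :=
    A.symm.toContinuousLinearMap.hasStrictFDerivAt.comp _
      (hf.prodMk (P ∘L .fst ℝ E Z).hasStrictFDerivAt)
  have hg_inl : (A.symm.toContinuousLinearMap ∘L D.prod (P ∘L .fst ℝ E Z)) ∘L .inl ℝ E Z =
      .id ℝ E := by
    ext t
    exact A.symm_apply_apply t
  obtain ⟨U, hU, V, hV, hUV⟩ := exists_measure_le_two_mul_image μ hg hg_inl
  obtain ⟨c, hc⟩ := exists_measure_preimage_prod_eq μ lam (.addHaar : Measure L.ker) A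
  have hκ : (.addHaar : Measure L.ker) (P '' Metric.ball t₀ 1) ≠ ⊤ :=
    ((Metric.isBounded_ball.image P).measure_lt_top).ne
  refine ⟨(2 * c * (.addHaar : Measure L.ker) (P '' Metric.ball t₀ 1)).toNNReal,
    U ∩ Metric.ball t₀ 1, Filter.inter_mem hU (Metric.ball_mem_nhds t₀ one_pos), V, hV,
    fun z hz S hS ↦ ?_⟩
  rw [ENNReal.coe_toNNReal (by finiteness)]
  have himage : (fun t ↦ g (t, z)) '' S ⊆
      A ⁻¹' (((fun t ↦ f (t, z)) '' S) ×ˢ (P '' Metric.ball t₀ 1)) := by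
    rintro _ ⟨t, ht, rfl⟩
    simp only [Set.mem_preimage, g, A.apply_symm_apply]
    exact ⟨Set.mem_image_of_mem _ ht, Set.mem_image_of_mem _ (hS ht).2⟩
  calc μ S ≤ 2 * μ ((fun t ↦ g (t, z)) '' S) := hUV z hz S (hS.trans Set.inter_subset_left)
    _ ≤ 2 * (c * (lam ((fun t ↦ f (t, z)) '' S) *
          (.addHaar : Measure L.ker) (P '' Metric.ball t₀ 1))) := by
        grw [himage, hc]
    _ = _ := by ring

end SubmersionDensity

section LOneContinuity

lemma lintegral_comp_le_of_map_le {T N : Type*} [MeasurableSpace T] [MeasurableSpace N]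
    {ν : Measure T} {lam : Measure N} {φ : T → N} (hφ : AEMeasurable φ ν)
    (hφ_map : ν.map φ ≤ lam) {H : N → ENNReal} (hH : AEMeasurable H lam) :
    ∫⁻ t, H (φ t) ∂ν ≤ ∫⁻ y, H y ∂lam :=
  (lintegral_map' (hH.mono_measure hφ_map) hφ).symm.trans_le (lintegral_mono' hφ_map le_rfl)

lemma map_restrict_le_smul_restrict {T N : Type*} [MeasurableSpace T] [MeasurableSpace N]
    {μ : Measure T} {lam : Measure N} {φ : T → N} {K : Set T} {B : Set N} {C : NNReal}
    (hK : MeasurableSet K) (hφ : AEMeasurable φ (μ.restrict K)) (hφB : Set.MapsTo φ K B)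
    (hφ_image : ∀ S ⊆ K, μ S ≤ C * lam (φ '' S)) :
    (μ.restrict K).map φ ≤ C • lam.restrict B := by
  refine Measure.le_iff.2 fun A hA ↦ ?_
  rw [Measure.map_apply_of_aemeasurable hφ hA, Measure.restrict_apply' hK, Measure.smul_apply,
    Measure.restrict_apply hA]
  refine (hφ_image _ Set.inter_subset_right).trans (mul_le_mul_right (measure_mono ?_) _)
  rintro _ ⟨t, ⟨htA, htK⟩, rfl⟩
  exact ⟨htA, hφB htK⟩

section

variable {ι T N : Type*} [MeasurableSpace T] {ν : Measure T} [IsFiniteMeasure ν]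
  [TopologicalSpace N] [MeasurableSpace N] [BorelSpace N]
  {l : Filter ι} [l.IsCountablyGenerated] {φ : ι → T → N} {φ₀ : T → N}

lemma tendsto_lintegral_enorm_boundedContinuous_comp_sub
    (hφ : ∀ᶠ i in l, AEMeasurable (φ i) ν) (hφ₀ : AEMeasurable φ₀ ν)
    (hlim : ∀ᵐ t ∂ν, Filter.Tendsto (φ · t) l (𝓝 (φ₀ t))) (g : BoundedContinuousFunction N ℝ) :
    Filter.Tendsto (fun i ↦ ∫⁻ t, ‖g (φ i t) - g (φ₀ t)‖ₑ ∂ν) l (𝓝 0) := by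
  rw [← lintegral_zero (μ := ν)]
  refine tendsto_lintegral_filter_of_dominated_convergence' (fun _ ↦ ENNReal.ofReal (2 * ‖g‖))
    ?_ (.of_forall fun i ↦ .of_forall fun t ↦ ?_) ?_ ?_
  · filter_upwards [hφ] with i hi
    exact ((g.continuous.measurable.comp_aemeasurable hi).sub
      (g.continuous.measurable.comp_aemeasurable hφ₀)).enorm
  · rw [← ofReal_norm, ← dist_eq_norm]
    exact ENNReal.ofReal_le_ofReal (g.dist_le_two_norm _ _)
  · rw [lintegral_const]
    finiteness
  · filter_upwards [hlim] with t ht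
    simpa using (((g.continuous.tendsto _).comp ht).sub_const (g (φ₀ t))).enorm

/-- The law of `φ i` is dominated by `lam`, so `G` may be replaced by a bounded continuous function
that is close to it in `L¹(lam)`. -/
lemma tendsto_lintegral_enorm_comp_sub [NormalSpace N] {lam : Measure N} [lam.WeaklyRegular]
    (hφ : ∀ᶠ i in l, AEMeasurable (φ i) ν) (hφ_map : ∀ᶠ i in l, ν.map (φ i) ≤ lam)
    (hφ₀ : AEMeasurable φ₀ ν) (hφ₀_map : ν.map φ₀ ≤ lam)
    (hlim : ∀ᵐ t ∂ν, Filter.Tendsto (φ · t) l (𝓝 (φ₀ t))) {G : N → ℝ} (hG : Integrable G lam) :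
    Filter.Tendsto (fun i ↦ ∫⁻ t, ‖G (φ i t) - G (φ₀ t)‖ₑ ∂ν) l (𝓝 0) := by
  refine ENNReal.tendsto_nhds_zero.2 fun η hη ↦ ?_
  obtain ⟨g, hg, -⟩ := hG.exists_boundedContinuous_lintegral_sub_le
    (ENNReal.div_pos hη.ne' (by simp : (3 : ENNReal) ≠ ⊤)).ne'
  have hdiff : AEMeasurable (fun y ↦ ‖G y - g y‖ₑ) lam :=
    (hG.aemeasurable.sub g.continuous.measurable.aemeasurable).enorm
  have hdiff_comp {ψ : T → N} (hψ : AEMeasurable ψ ν) (hψ_map : ν.map ψ ≤ lam) :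
      AEMeasurable (fun t ↦ ‖G (ψ t) - g (ψ t)‖ₑ) ν :=
    (hdiff.mono_measure hψ_map).comp_aemeasurable hψ
  have happrox {ψ : T → N} (hψ : AEMeasurable ψ ν) (hψ_map : ν.map ψ ≤ lam) :
      ∫⁻ t, ‖G (ψ t) - g (ψ t)‖ₑ ∂ν ≤ η / 3 :=
    (lintegral_comp_le_of_map_le hψ hψ_map hdiff).trans hg
  have hcont := ENNReal.tendsto_nhds_zero.1
    (tendsto_lintegral_enorm_boundedContinuous_comp_sub hφ hφ₀ hlim g) (η / 3)
    (ENNReal.div_pos hη.ne' (by simp))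
  filter_upwards [hφ, hφ_map, hcont] with i hi hi_map hi_cont
  calc ∫⁻ t, ‖G (φ i t) - G (φ₀ t)‖ₑ ∂ν
      ≤ ∫⁻ t, (‖G (φ i t) - g (φ i t)‖ₑ + ‖g (φ i t) - g (φ₀ t)‖ₑ) +
          ‖G (φ₀ t) - g (φ₀ t)‖ₑ ∂ν := by
        refine lintegral_mono fun t ↦ ?_
        simp only [← edist_eq_enorm_sub, edist_comm (G (φ₀ t))]
        exact edist_triangle4 _ _ _ _
    _ = ∫⁻ t, ‖G (φ i t) - g (φ i t)‖ₑ ∂ν + ∫⁻ t, ‖g (φ i t) - g (φ₀ t)‖ₑ ∂ν +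
          ∫⁻ t, ‖G (φ₀ t) - g (φ₀ t)‖ₑ ∂ν := by
        rw [lintegral_add_right' _ (hdiff_comp hφ₀ hφ₀_map),
          lintegral_add_left' (hdiff_comp hi hi_map)]
    _ ≤ η / 3 + η / 3 + η / 3 := by
        gcongr
        exacts [happrox hi hi_map, happrox hφ₀ hφ₀_map]
    _ = η := ENNReal.add_thirds η

end

lemma exists_tendsto_lintegral_enorm_comp_sub {E F Z : Type*} [NormedAddCommGroup E]
    [NormedSpace ℝ E] [FiniteDimensional ℝ E] [MeasurableSpace E] [BorelSpace E]
    (μ : Measure E) [μ.IsAddHaarMeasure] [NormedAddCommGroup F] [NormedSpace ℝ F]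
    [FiniteDimensional ℝ F] [MeasurableSpace F] [BorelSpace F] [NormedAddCommGroup Z]
    [NormedSpace ℝ Z] {f : E × Z → F} {D : E × Z →L[ℝ] F} {t₀ : E} {z₀ : Z}
    (hf : HasStrictFDerivAt f D (t₀, z₀)) (hD : Function.Surjective (D ∘L .inl ℝ E Z))
    (hf_cont : ∀ᶠ q in 𝓝 (t₀, z₀), ContinuousAt f q) {G : F → ℝ} (hG : Measurable G) {b : ℝ}
    (hb : ∀ y, |G y| ≤ b) :
    ∃ K ∈ 𝓝 t₀, Filter.Tendsto (fun z ↦ ∫⁻ t in K, ‖G (f (t, z)) - G (f (t, z₀))‖ₑ ∂μ)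
      (𝓝 z₀) (𝓝 0) := by
  let B := Metric.ball (f (t₀, z₀)) 1
  have : IsFiniteMeasure ((Measure.addHaar : Measure F).restrict B) :=
    isFiniteMeasure_restrict.2 measure_ball_lt_top.ne
  obtain ⟨C, U, hU, V, hV, hUV⟩ := exists_measure_le_mul_image μ Measure.addHaar hf hD
  obtain ⟨U', hU', V', hV', hUV'⟩ := mem_nhds_prod_iff.1
    (hf_cont.and (hf_cont.self_of_nhds.eventually (Metric.ball_mem_nhds _ one_pos)))
  obtain ⟨r, hr, hrU⟩ := Metric.mem_nhds_iff.1 (Filter.inter_mem hU hU')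
  let K := Metric.ball t₀ r
  have : IsFiniteMeasure (μ.restrict K) := isFiniteMeasure_restrict.2 measure_ball_lt_top.ne
  have hK_cont (z) (hz : z ∈ V') : ContinuousOn (fun t ↦ f (t, z)) K := fun t ht ↦
    (ContinuousAt.comp (g := f) (f := fun t ↦ (t, z)) (hUV' ⟨(hrU ht).2, hz⟩).1
      (by fun_prop)).continuousWithinAt
  have hK_ae (z) (hz : z ∈ V') : AEMeasurable (fun t ↦ f (t, z)) (μ.restrict K) :=
    (hK_cont z hz).aemeasurable measurableSet_ball
  have hK_map (z) (hz : z ∈ V ∩ V') :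
      (μ.restrict K).map (fun t ↦ f (t, z)) ≤ C • (Measure.addHaar : Measure F).restrict B :=
    map_restrict_le_smul_restrict measurableSet_ball (hK_ae z hz.2)
      (fun t ht ↦ (hUV' ⟨(hrU ht).2, hz.2⟩).2)
      fun S hS ↦ hUV z hz.1 S fun t ht ↦ (hrU (hS ht)).1
  refine ⟨K, Metric.ball_mem_nhds t₀ hr, tendsto_lintegral_enorm_comp_sub
    (lam := C • (Measure.addHaar : Measure F).restrict B) (Filter.eventually_of_mem hV' hK_ae)
    (Filter.eventually_of_mem (Filter.inter_mem hV hV') hK_map) (hK_ae _ (mem_of_mem_nhds hV'))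
    (hK_map _ (mem_of_mem_nhds (Filter.inter_mem hV hV'))) ?_
    (.of_bound hG.aestronglyMeasurable b (.of_forall hb))⟩
  filter_upwards [ae_restrict_mem measurableSet_ball] with t ht
  exact ContinuousAt.comp (g := f) (f := fun z ↦ (t, z))
    (hUV' ⟨(hrU ht).2, mem_of_mem_nhds hV'⟩).1 (by fun_prop)

end LOneContinuity

section ManifoldSubmersions

variable {d : ℕ} {M : Type*} [TopologicalSpace M] [ChartedSpace (EuclideanSpace ℝ (Fin d)) M]
  {E : Type*} [NormedAddCommGroup E] [NormedSpace ℝ E]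

lemma surjective_mfderiv_iff_fderiv_extChartAt [IsManifold (𝓡 d) 1 M] {φ : E → M} {t : E} {y₀ : M}
    (hφ : MDifferentiableAt 𝓘(ℝ, E) (𝓡 d) φ t) (hy : φ t ∈ (extChartAt (𝓡 d) y₀).source) :
    Function.Surjective (mfderiv 𝓘(ℝ, E) (𝓡 d) φ t) ↔
      Function.Surjective (fderiv ℝ (extChartAt (𝓡 d) y₀ ∘ φ) t) := by
  have hinv := isInvertible_mfderiv_extChartAt (I := 𝓡 d) hy
  rw [← mfderiv_eq_fderiv,
    mfderiv_comp t (mdifferentiableAt_extChartAt (by rwa [extChartAt_source] at hy)) hφ]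
  exact ⟨fun h ↦ hinv.surjective.comp h, fun h ↦ Function.Surjective.of_comp_left h hinv.injective⟩

variable [IsManifold (𝓡 d) ω M] {Φ : E × M → M}

/-- The coordinate expression of a family of maps into a manifold that depends on a point of the
manifold. -/
noncomputable def chartFamily (x₀ y₀ : M) (Φ : E × M → M)
    (q : E × EuclideanSpace ℝ (Fin d)) : EuclideanSpace ℝ (Fin d) :=
  extChartAt (𝓡 d) y₀ (Φ (q.1, (extChartAt (𝓡 d) x₀).symm q.2))

lemma contDiffAt_chartFamily (hΦ : ContMDiff (𝓘(ℝ, E).prod (𝓡 d)) (𝓡 d) ω Φ) {x₀ y₀ x : M} {t : E}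
    (hx : x ∈ (extChartAt (𝓡 d) x₀).source) (hy : Φ (t, x) ∈ (extChartAt (𝓡 d) y₀).source) :
    ContDiffAt ℝ ω (chartFamily x₀ y₀ Φ) (t, extChartAt (𝓡 d) x₀ x) := by
  have hcoord : ContMDiffAt (𝓘(ℝ, E).prod (𝓡 d)) (𝓘(ℝ, E).prod (𝓡 d)) ω
      (fun q : E × EuclideanSpace ℝ (Fin d) ↦ (q.1, (extChartAt (𝓡 d) x₀).symm q.2))
      (t, extChartAt (𝓡 d) x₀ x) :=
    contMDiffAt_fst.prodMk (ContMDiffAt.comp (g := (extChartAt (𝓡 d) x₀).symm) _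
      (contMDiffAt_extChartAt_symm_target ((extChartAt (𝓡 d) x₀).map_source hx)) contMDiffAt_snd)
  have hfamily : ContMDiffAt (𝓘(ℝ, E).prod (𝓡 d)) (𝓡 d) ω
      (chartFamily x₀ y₀ Φ) (t, extChartAt (𝓡 d) x₀ x) := by
    refine ContMDiffAt.comp (g := extChartAt (𝓡 d) y₀) _ (contMDiffAt_extChartAt' ?_)
      (ContMDiffAt.comp (g := Φ) _ (hΦ _) hcoord)
    rw [extChartAt_source] at hy
    rwa [(extChartAt (𝓡 d) x₀).left_inv hx]
  rw [← contMDiffAt_iff_contDiffAt, modelWithCornersSelf_prod, ← chartedSpaceSelf_prod]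
  exact hfamily

lemma surjective_mfderiv_iff_chartFamily (hΦ : ContMDiff (𝓘(ℝ, E).prod (𝓡 d)) (𝓡 d) ω Φ)
    {x₀ y₀ x : M} {t : E} (hx : x ∈ (extChartAt (𝓡 d) x₀).source)
    (hy : Φ (t, x) ∈ (extChartAt (𝓡 d) y₀).source) :
    Function.Surjective (mfderiv 𝓘(ℝ, E) (𝓡 d) (fun t ↦ Φ (t, x)) t) ↔
      Function.Surjective (fderiv ℝ (chartFamily x₀ y₀ Φ) (t, extChartAt (𝓡 d) x₀ x) ∘L
        .inl ℝ E (EuclideanSpace ℝ (Fin d))) := by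
  have hslice : ContMDiffAt 𝓘(ℝ, E) (𝓡 d) ω (fun t ↦ Φ (t, x)) t :=
    ContMDiffAt.comp (g := Φ) t (hΦ _) (contMDiffAt_id.prodMk contMDiffAt_const)
  have hchart : extChartAt (𝓡 d) y₀ ∘ (fun t ↦ Φ (t, x)) =
      fun t ↦ chartFamily x₀ y₀ Φ (t, extChartAt (𝓡 d) x₀ x) := by
    ext1 t
    simp only [chartFamily, (extChartAt (𝓡 d) x₀).left_inv hx, Function.comp_apply]
  have hderiv : HasFDerivAt (fun t ↦ chartFamily x₀ y₀ Φ (t, extChartAt (𝓡 d) x₀ x))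
      (fderiv ℝ (chartFamily x₀ y₀ Φ) (t, extChartAt (𝓡 d) x₀ x) ∘L
        .inl ℝ E (EuclideanSpace ℝ (Fin d))) t :=
    HasFDerivAt.comp (g := chartFamily x₀ y₀ Φ) (f := fun t ↦ (t, extChartAt (𝓡 d) x₀ x)) t
      ((contDiffAt_chartFamily hΦ hx hy).differentiableAt (by simp)).hasFDerivAt
      (hasFDerivAt_prodMk_left t (extChartAt (𝓡 d) x₀ x))
  rw [surjective_mfderiv_iff_fderiv_extChartAt (hslice.mdifferentiableAt (by simp)) hy, hchart,
    hderiv.fderiv]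

lemma eventually_surjective_mfderiv (hΦ : ContMDiff (𝓘(ℝ, E).prod (𝓡 d)) (𝓡 d) ω Φ)
    {x₀ : M} {t₀ : E}
    (hsurj : Function.Surjective (mfderiv 𝓘(ℝ, E) (𝓡 d) (fun t ↦ Φ (t, x₀)) t₀)) :
    ∀ᶠ p in 𝓝 (t₀, x₀),
      Function.Surjective (mfderiv 𝓘(ℝ, E) (𝓡 d) (fun t ↦ Φ (t, p.2)) p.1) := by
  let y₀ := Φ (t₀, x₀)
  have hx : x₀ ∈ (extChartAt (𝓡 d) x₀).source := mem_extChartAt_source x₀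
  have hy : Φ (t₀, x₀) ∈ (extChartAt (𝓡 d) y₀).source := mem_extChartAt_source y₀
  rw [surjective_mfderiv_iff_chartFamily hΦ hx hy] at hsurj
  have hcoord : ContinuousAt (fun p : E × M ↦ (p.1, extChartAt (𝓡 d) x₀ p.2)) (t₀, x₀) :=
    continuousAt_fst.prodMk (ContinuousAt.comp (g := extChartAt (𝓡 d) x₀) (f := Prod.snd)
      (continuousAt_extChartAt x₀) continuousAt_snd)
  have hfderiv : ContinuousAt (fderiv ℝ (chartFamily x₀ y₀ Φ)) (t₀, extChartAt (𝓡 d) x₀ x₀) :=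
    ((contDiffAt_chartFamily hΦ hx hy).fderiv_right (m := 0) (by simp)).continuousAt
  have hpartial : ContinuousAt (fun p : E × M ↦ fderiv ℝ (chartFamily x₀ y₀ Φ)
      (p.1, extChartAt (𝓡 d) x₀ p.2) ∘L .inl ℝ E (EuclideanSpace ℝ (Fin d))) (t₀, x₀) :=
    (ContinuousAt.comp (f := fun p : E × M ↦ (p.1, extChartAt (𝓡 d) x₀ p.2)) hfderiv
      hcoord).clm_comp continuousAt_const
  filter_upwards [hpartial (isOpen_setOf_surjective_clm.mem_nhds hsurj),
    continuousAt_snd.eventually (extChartAt_source_mem_nhds (I := 𝓡 d) x₀),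
    hΦ.continuous.continuousAt.eventually (extChartAt_source_mem_nhds (I := 𝓡 d) y₀)]
    with p hp hp_source hp_target
  exact (surjective_mfderiv_iff_chartFamily hΦ hp_source hp_target).2 hp

variable {φ : E → M}

lemma eventually_surjective_mfderiv_line_of_frequently
    (hφ : ContMDiff 𝓘(ℝ, E) (𝓡 d) ω φ) {t v : E} {s₀ : ℝ}
    (hsurj : ∃ᶠ s : ℝ in 𝓝 s₀, Function.Surjective (mfderiv 𝓘(ℝ, E) (𝓡 d) φ (t + s • v))) :
    ∀ᶠ s : ℝ in 𝓝[≠] s₀, Function.Surjective (mfderiv 𝓘(ℝ, E) (𝓡 d) φ (t + s • v)) := by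
  let y₀ := φ (t + s₀ • v)
  have hline : AnalyticAt ℝ (fun s : ℝ ↦ t + s • v) s₀ := by fun_prop
  have hchart : ContDiffAt ℝ ω (extChartAt (𝓡 d) y₀ ∘ φ) (t + s₀ • v) :=
    ContMDiffAt.contDiffAt (ContMDiffAt.comp _ contMDiffAt_extChartAt (hφ _))
  have hJ : AnalyticAt ℝ (fun s : ℝ ↦ fderiv ℝ (extChartAt (𝓡 d) y₀ ∘ φ) (t + s • v)) s₀ :=
    AnalyticAt.comp (g := fderiv ℝ (extChartAt (𝓡 d) y₀ ∘ φ)) (f := fun s : ℝ ↦ t + s • v)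
      hchart.analyticAt.fderiv hline
  have hφ_line : ContinuousAt (fun s : ℝ ↦ φ (t + s • v)) s₀ :=
    ContinuousAt.comp (g := φ) hφ.continuous.continuousAt hline.continuousAt
  have hiff : ∀ᶠ s in 𝓝 s₀, (Function.Surjective (mfderiv 𝓘(ℝ, E) (𝓡 d) φ (t + s • v)) ↔
      Function.Surjective (fderiv ℝ (extChartAt (𝓡 d) y₀ ∘ φ) (t + s • v))) := by
    filter_upwards [hφ_line.eventually (extChartAt_source_mem_nhds (I := 𝓡 d) y₀)] with s hs
    exact surjective_mfderiv_iff_fderiv_extChartAt ((hφ _).mdifferentiableAt (by simp)) hs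
  filter_upwards [eventually_surjective_of_analyticAt_of_frequently hJ
    ((hsurj.and_eventually hiff).mono fun s hs ↦ hs.2.1 hs.1), nhdsWithin_le_nhds hiff]
    with s hs hs_iff
  exact hs_iff.2 hs

lemma isOpen_setOf_surjective_mfderiv (hφ : ContMDiff 𝓘(ℝ, E) (𝓡 d) ω φ) :
    IsOpen {t | Function.Surjective (mfderiv 𝓘(ℝ, E) (𝓡 d) φ t)} :=
  isOpen_iff_mem_nhds.2 fun t ht ↦
    (by fun_prop : ContinuousAt (fun s : E ↦ (s, φ t)) t).eventually
      (eventually_surjective_mfderiv (Φ := fun p ↦ φ p.1) (hφ.comp contMDiff_fst) ht)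

lemma ae_surjective_mfderiv [FiniteDimensional ℝ E] [MeasurableSpace E] [BorelSpace E]
    (μ : Measure E) [μ.IsAddHaarMeasure] (hφ : ContMDiff 𝓘(ℝ, E) (𝓡 d) ω φ) {t₁ : E}
    (hsurj : Function.Surjective (mfderiv 𝓘(ℝ, E) (𝓡 d) φ t₁)) :
    ∀ᵐ t ∂μ, Function.Surjective (mfderiv 𝓘(ℝ, E) (𝓡 d) φ t) :=
  ae_of_forall_ae_line μ (isOpen_setOf_surjective_mfderiv hφ).measurableSet t₁ fun v ↦
    ae_of_frequently_imp_eventually_nhdsNE (x₁ := 0) (by rwa [zero_smul, add_zero])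
      fun _ ↦ eventually_surjective_mfderiv_line_of_frequently hφ

end ManifoldSubmersions

section AbsoluteContinuity

variable {ι T : Type*} [MeasurableSpace T] {ν : Measure T} [IsFiniteMeasure ν] {l : Filter ι}

lemma tendsto_measure_zero_of_absolutelyContinuous {μ : Measure T} [SigmaFinite μ] (hν : ν ≪ μ)
    {s : ι → Set T} (hs : Filter.Tendsto (fun i ↦ μ (s i)) l (𝓝 0)) :
    Filter.Tendsto (fun i ↦ ν (s i)) l (𝓝 0) := by
  simp_rw [← Measure.setLIntegral_rnDeriv hν]
  exact tendsto_setLIntegral_zero (Measure.lintegral_rnDeriv_lt_top ν μ).ne hs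

lemma tendsto_lintegral_zero_of_absolutelyContinuous {μ : Measure T} [SigmaFinite μ] (hν : ν ≪ μ)
    {F : ι → T → ENNReal} (hF : ∀ i, Measurable (F i)) {b : ENNReal} (hb : b ≠ ⊤)
    (hF_le : ∀ i t, F i t ≤ b) (hlim : Filter.Tendsto (fun i ↦ ∫⁻ t, F i t ∂μ) l (𝓝 0)) :
    Filter.Tendsto (fun i ↦ ∫⁻ t, F i t ∂ν) l (𝓝 0) := by
  refine ENNReal.tendsto_nhds_zero.2 fun η hη ↦ ?_
  have hη₂ : η / 2 ≠ 0 := (ENNReal.half_pos hη.ne').ne'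
  obtain ⟨δ, hδ, hδη⟩ := ENNReal.exists_nnreal_pos_mul_lt (measure_ne_top ν Set.univ) hη₂
  have hδ₀ : (δ : ENNReal) ≠ 0 := ENNReal.coe_ne_zero.2 hδ.ne'
  have hlarge_μ : Filter.Tendsto (fun i ↦ μ {t | δ ≤ F i t}) l (𝓝 0) := by
    refine tendsto_of_tendsto_of_tendsto_of_le_of_le tendsto_const_nhds ?_ (fun _ ↦ zero_le)
      fun i ↦ meas_ge_le_lintegral_div (hF i).aemeasurable hδ₀ ENNReal.coe_ne_top
    simpa only [ENNReal.zero_div] using ENNReal.Tendsto.div_const hlim (Or.inr hδ₀)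
  have hlarge_ν : Filter.Tendsto (fun i ↦ b * ν {t | δ ≤ F i t}) l (𝓝 0) := by
    simpa only [mul_zero] using ENNReal.Tendsto.const_mul
      (tendsto_measure_zero_of_absolutelyContinuous hν hlarge_μ) (Or.inr hb)
  filter_upwards [ENNReal.tendsto_nhds_zero.1 hlarge_ν _ (pos_iff_ne_zero.2 hη₂)] with i hi
  have hmeas : MeasurableSet {t | δ ≤ F i t} := measurableSet_le measurable_const (hF i)
  calc ∫⁻ t, F i t ∂ν
      = ∫⁻ t in {t | δ ≤ F i t}, F i t ∂ν + ∫⁻ t in {t | δ ≤ F i t}ᶜ, F i t ∂ν :=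
        (lintegral_add_compl _ hmeas).symm
    _ ≤ ∫⁻ _ in {t | δ ≤ F i t}, b ∂ν + ∫⁻ _ in {t | δ ≤ F i t}ᶜ, δ ∂ν := by
        refine add_le_add (lintegral_mono (hF_le i))
          (setLIntegral_mono measurable_const fun t (ht : ¬ δ ≤ F i t) ↦ (not_le.1 ht).le)
    _ ≤ b * ν {t | δ ≤ F i t} + δ * ν Set.univ := by
        rw [setLIntegral_const, setLIntegral_const]
        gcongr
        exact Set.subset_univ _
    _ ≤ η / 2 + η / 2 := add_le_add hi hδη.le
    _ = η := ENNReal.add_halves η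

lemma tendsto_lintegral_zero_of_locally [TopologicalSpace T] [T2Space T] [OpensMeasurableSpace T]
    [ν.InnerRegularCompactLTTop] {O : Set T} (hO : MeasurableSet O) (hνO : ν Oᶜ = 0)
    {F : ι → T → ENNReal} {b : ENNReal} (hb : b ≠ ⊤) (hF_le : ∀ i t, F i t ≤ b)
    (hloc : ∀ t ∈ O, ∃ K ∈ 𝓝 t, Filter.Tendsto (fun i ↦ ∫⁻ t in K, F i t ∂ν) l (𝓝 0)) :
    Filter.Tendsto (fun i ↦ ∫⁻ t, F i t ∂ν) l (𝓝 0) := by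
  have hcompact : ∀ L : Set T, IsCompact L → L ⊆ O →
      Filter.Tendsto (fun i ↦ ∫⁻ t in L, F i t ∂ν) l (𝓝 0) := fun L hL hLO ↦ by
    refine hL.induction_on (p := fun L ↦ Filter.Tendsto (fun i ↦ ∫⁻ t in L, F i t ∂ν) l (𝓝 0))
      (by simp [tendsto_const_nhds]) (fun A B hAB hB ↦ ?_) (fun A B hA hB ↦ ?_) fun t ht ↦ ?_
    · exact tendsto_of_tendsto_of_tendsto_of_le_of_le tendsto_const_nhds hB
        (fun _ ↦ zero_le) fun _ ↦ lintegral_mono_set hAB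
    · exact tendsto_of_tendsto_of_tendsto_of_le_of_le tendsto_const_nhds
        (by simpa only [add_zero] using hA.add hB) (fun _ ↦ zero_le)
        fun _ ↦ lintegral_union_le _ _ _
    · obtain ⟨K, hK, hKlim⟩ := hloc t (hLO ht)
      exact ⟨K, mem_nhdsWithin_of_mem_nhds hK, hKlim⟩
  refine ENNReal.tendsto_nhds_zero.2 fun η hη ↦ ?_
  have hη₂ : η / 2 ≠ 0 := (ENNReal.half_pos hη.ne').ne'
  obtain ⟨δ, hδ, hδη⟩ := ENNReal.exists_nnreal_pos_mul_lt hb hη₂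
  obtain ⟨L, hLO, hL, hLν⟩ := hO.exists_isCompact_sdiff_lt (measure_ne_top ν O)
    (ENNReal.coe_ne_zero.2 hδ.ne')
  have hLc : ν Lᶜ ≤ δ :=
    calc ν Lᶜ ≤ ν (O \ L ∪ Oᶜ) := measure_mono fun t ht ↦ by tauto
      _ ≤ ν (O \ L) + ν Oᶜ := measure_union_le _ _
      _ ≤ δ := by rw [hνO, add_zero]; exact hLν.le
  filter_upwards [ENNReal.tendsto_nhds_zero.1 (hcompact L hL hLO) _ (pos_iff_ne_zero.2 hη₂)]
    with i hi
  calc ∫⁻ t, F i t ∂ν = ∫⁻ t in L, F i t ∂ν + ∫⁻ t in Lᶜ, F i t ∂ν :=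
        (lintegral_add_compl _ hL.measurableSet).symm
    _ ≤ η / 2 + ∫⁻ _ in Lᶜ, b ∂ν := by gcongr with t; exact hF_le i t
    _ ≤ η / 2 + δ * b := by rw [setLIntegral_const, mul_comm]; gcongr
    _ ≤ η := (add_le_add_right hδη.le _).trans (ENNReal.add_halves η).le

end AbsoluteContinuity

section StrongFeller

variable {d : ℕ} {M : Type*} [TopologicalSpace M] [ChartedSpace (EuclideanSpace ℝ (Fin d)) M]
  [IsManifold (𝓡 d) ω M] [MeasurableSpace M] [BorelSpace M]
  {E : Type*} [NormedAddCommGroup E] [NormedSpace ℝ E] [FiniteDimensional ℝ E]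
  [MeasurableSpace E] [BorelSpace E] (μ : Measure E) [μ.IsAddHaarMeasure] {Φ : E × M → M}

lemma exists_tendsto_lintegral_enorm_comp_sub_of_surjective_mfderiv
    (hΦ : ContMDiff (𝓘(ℝ, E).prod (𝓡 d)) (𝓡 d) ω Φ) {x₀ : M} {t₀ : E}
    (hsurj : Function.Surjective (mfderiv 𝓘(ℝ, E) (𝓡 d) (fun t ↦ Φ (t, x₀)) t₀))
    {g : M → ℝ} (hg : Measurable g) {b : ℝ} (hb : ∀ y, |g y| ≤ b) :
    ∃ K ∈ 𝓝 t₀, Filter.Tendsto (fun x ↦ ∫⁻ t in K, ‖g (Φ (t, x)) - g (Φ (t, x₀))‖ₑ ∂μ)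
      (𝓝 x₀) (𝓝 0) := by
  classical
  let y₀ := Φ (t₀, x₀)
  let f := chartFamily (d := d) x₀ y₀ Φ
  have hx : x₀ ∈ (extChartAt (𝓡 d) x₀).source := mem_extChartAt_source x₀
  have hy : Φ (t₀, x₀) ∈ (extChartAt (𝓡 d) y₀).source := mem_extChartAt_source y₀
  have hf : ContDiffAt ℝ ω f (t₀, extChartAt (𝓡 d) x₀ x₀) := contDiffAt_chartFamily hΦ hx hy
  let chartInv : EuclideanSpace ℝ (Fin d) → M :=
    (extChartAt (𝓡 d) y₀).target.piecewise (extChartAt (𝓡 d) y₀).symm (fun _ ↦ y₀)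
  have hchartInv : Measurable chartInv := (continuousOn_extChartAt_symm y₀).measurable_piecewise
    continuousOn_const (isOpen_extChartAt_target y₀).measurableSet
  have hcomp : ∀ᶠ p in 𝓝 (t₀, x₀), Φ p = chartInv (f (p.1, extChartAt (𝓡 d) x₀ p.2)) := by
    filter_upwards [hΦ.continuous.continuousAt.eventually
        (extChartAt_source_mem_nhds (I := 𝓡 d) y₀),
      (continuousAt_snd (p := (t₀, x₀))).eventually (extChartAt_source_mem_nhds (I := 𝓡 d) x₀)]
      with p hpy hpx
    simp only [f, chartFamily, chartInv, (extChartAt (𝓡 d) x₀).left_inv hpx, Prod.mk.eta]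
    rw [Set.piecewise_eq_of_mem _ _ _ ((extChartAt (𝓡 d) y₀).map_source hpy),
      (extChartAt (𝓡 d) y₀).left_inv hpy]
  obtain ⟨K, hK, hKlim⟩ := exists_tendsto_lintegral_enorm_comp_sub μ
    (hf.hasStrictFDerivAt (by simp)) ((surjective_mfderiv_iff_chartFamily hΦ hx hy).1 hsurj)
    ((hf.eventually (by simp)).mono fun _ hq ↦ hq.continuousAt) (hg.comp hchartInv)
    fun _ ↦ hb _
  obtain ⟨A, hA, B, hB, hAB⟩ := mem_nhds_prod_iff.1 hcomp
  obtain ⟨K', hK', hK'_open, htK'⟩ := mem_nhds_iff.1 (Filter.inter_mem hK hA)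
  refine ⟨K', hK'_open.mem_nhds htK', tendsto_of_tendsto_of_tendsto_of_le_of_le'
    tendsto_const_nhds (hKlim.comp (continuousAt_extChartAt x₀)) (.of_forall fun _ ↦ zero_le) ?_⟩
  filter_upwards [hB] with x hxB
  refine (setLIntegral_congr_fun hK'_open.measurableSet fun t ht ↦ ?_).trans_le
    (lintegral_mono_set fun t ht ↦ (hK' ht).1)
  rw [show Φ (t, x) = _ from hAB ⟨(hK' ht).2, hxB⟩,
    show Φ (t, x₀) = _ from hAB ⟨(hK' ht).2, mem_of_mem_nhds hB⟩]
  rfl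

lemma continuousAt_integral_comp_of_ae_surjective_mfderiv
    (hΦ : ContMDiff (𝓘(ℝ, E).prod (𝓡 d)) (𝓡 d) ω Φ) {ν : Measure E} [IsFiniteMeasure ν]
    (hν : ν ≪ μ) {x₀ : M}
    (hsurj : ∀ᵐ t ∂μ, Function.Surjective (mfderiv 𝓘(ℝ, E) (𝓡 d) (fun t ↦ Φ (t, x₀)) t))
    {g : M → ℝ} (hg : Measurable g) {b : ℝ} (hb : ∀ y, |g y| ≤ b) :
    ContinuousAt (fun x ↦ ∫ t, g (Φ (t, x)) ∂ν) x₀ := by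
  have hmeas : ∀ x, Measurable fun t ↦ g (Φ (t, x)) := fun x ↦
    hg.comp (hΦ.continuous.comp (by fun_prop : Continuous fun t : E ↦ (t, x))).measurable
  have hint : ∀ x, Integrable (fun t ↦ g (Φ (t, x))) ν := fun x ↦
    .of_bound (hmeas x).aestronglyMeasurable b (.of_forall fun t ↦ hb _)
  have hbound : ∀ x t, ‖g (Φ (t, x)) - g (Φ (t, x₀))‖ₑ ≤ ENNReal.ofReal (b + b) := fun x t ↦ by
    rw [← ofReal_norm]
    exact ENNReal.ofReal_le_ofReal ((norm_sub_le _ _).trans (add_le_add (hb _) (hb _)))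
  have hopen : IsOpen {t | Function.Surjective (mfderiv 𝓘(ℝ, E) (𝓡 d) (fun t ↦ Φ (t, x₀)) t)} :=
    isOpen_setOf_surjective_mfderiv (hΦ.comp (contMDiff_id.prodMk contMDiff_const))
  refine tendsto_integral_of_L1 _ (hint x₀).aestronglyMeasurable (.of_forall hint)
    (tendsto_lintegral_zero_of_locally hopen.measurableSet (hν hsurj) ENNReal.ofReal_ne_top hbound
      fun t ht ↦ ?_)
  obtain ⟨K, hK, hKlim⟩ :=
    exists_tendsto_lintegral_enorm_comp_sub_of_surjective_mfderiv μ hΦ ht hg hb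
  exact ⟨K, hK, tendsto_lintegral_zero_of_absolutelyContinuous (hν.restrict K)
    (fun x ↦ ((hmeas x).sub (hmeas x₀)).enorm) ENNReal.ofReal_ne_top hbound hKlim⟩

theorem exists_isOpen_continuousOn_integral_comp
    (hΦ : ContMDiff (𝓘(ℝ, E).prod (𝓡 d)) (𝓡 d) ω Φ) {ν : Measure E} [IsFiniteMeasure ν]
    (hν : ν ≪ μ) {x₀ : M} {t₀ : E}
    (hsurj : Function.Surjective (mfderiv 𝓘(ℝ, E) (𝓡 d) (fun t ↦ Φ (t, x₀)) t₀)) :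
    ∃ U : Set M, IsOpen U ∧ x₀ ∈ U ∧ ∀ g : M → ℝ, Measurable g → (∃ C : ℝ, ∀ x, |g x| ≤ C) →
      ContinuousOn (fun x ↦ ∫ t, g (Φ (t, x)) ∂ν) U := by
  obtain ⟨U, hU, hU_open, hxU⟩ := mem_nhds_iff.1
    ((by fun_prop : ContinuousAt (fun x : M ↦ (t₀, x)) x₀).eventually
      (eventually_surjective_mfderiv hΦ hsurj))
  refine ⟨U, hU_open, hxU, fun g hg ⟨b, hb⟩ x hx ↦ ContinuousAt.continuousWithinAt ?_⟩
  have hslice : ContMDiff 𝓘(ℝ, E) (𝓡 d) ω (fun t ↦ Φ (t, x)) :=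
    hΦ.comp (contMDiff_id.prodMk contMDiff_const)
  exact continuousAt_integral_comp_of_ae_surjective_mfderiv μ hΦ hν
    (ae_surjective_mfderiv μ hslice (hU hx)) hg hb

end StrongFeller

/-! ### Maximal rank and the Lie hull -/

section Tangency

variable {F K : Type*} [NormedAddCommGroup F] [NormedSpace ℝ F]
  [NormedAddCommGroup K] [NormedSpace ℝ K] [CompleteSpace K]
  {ψ : K → F} {k : K} {P : F →L[ℝ] K} {V W : F → F}

lemma exists_differentiableAt_lift_of_eventually_mem_range (hψ : ContDiffAt ℝ 2 ψ k)
    (hP : IsUnit (P ∘L fderiv ℝ ψ k)) (hV : DifferentiableAt ℝ V (ψ k))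
    (hV_tangent : ∀ᶠ l in 𝓝 k, V (ψ l) ∈ Set.range (fderiv ℝ ψ l)) :
    ∃ v : K → K, DifferentiableAt ℝ v k ∧ (fun l ↦ fderiv ℝ ψ l (v l)) =ᶠ[𝓝 k] V ∘ ψ := by
  have hB : DifferentiableAt ℝ (fun l ↦ P ∘L fderiv ℝ ψ l) k :=
    (differentiableAt_const P).clm_comp
      ((hψ.fderiv_right (m := 1) (by norm_num)).differentiableAt (by norm_num))
  have hB_inv : DifferentiableAt ℝ (fun l ↦ Ring.inverse (P ∘L fderiv ℝ ψ l)) k :=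
    DifferentiableAt.comp (g := Ring.inverse) k (differentiableAt_inverse hP) hB
  refine ⟨fun l ↦ Ring.inverse (P ∘L fderiv ℝ ψ l) (P (V (ψ l))), hB_inv.clm_apply
    (P.differentiableAt.comp k (hV.comp k (hψ.differentiableAt (by norm_num)))), ?_⟩
  filter_upwards [hB.continuousAt.eventually (Units.isOpen.mem_nhds hP), hV_tangent]
    with l hl ⟨w, hw⟩
  have hlift : Ring.inverse (P ∘L fderiv ℝ ψ l) (P (fderiv ℝ ψ l w)) = w :=
    DFunLike.congr_fun (Ring.inverse_mul_cancel _ hl) w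
  rw [← hw, hlift, hw, Function.comp_apply]

lemma lieBracket_mem_range_fderiv (hψ : ContDiffAt ℝ 2 ψ k) (hP : IsUnit (P ∘L fderiv ℝ ψ k))
    (hV : DifferentiableAt ℝ V (ψ k)) (hW : DifferentiableAt ℝ W (ψ k))
    (hV_tangent : ∀ᶠ l in 𝓝 k, V (ψ l) ∈ Set.range (fderiv ℝ ψ l))
    (hW_tangent : ∀ᶠ l in 𝓝 k, W (ψ l) ∈ Set.range (fderiv ℝ ψ l)) :
    VectorField.lieBracket ℝ V W (ψ k) ∈ Set.range (fderiv ℝ ψ k) := by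
  obtain ⟨v, hv, hvV⟩ := exists_differentiableAt_lift_of_eventually_mem_range hψ hP hV hV_tangent
  obtain ⟨w, hw, hwW⟩ := exists_differentiableAt_lift_of_eventually_mem_range hψ hP hW hW_tangent
  have hψ_diff : DifferentiableAt ℝ ψ k := hψ.differentiableAt (by norm_num)
  refine ⟨VectorField.lieBracket ℝ v w k, ?_⟩
  rw [VectorField.fderiv_apply_lieBracket hψ (by simp) hw hv, hwW.fderiv_eq, hvV.fderiv_eq,
    fderiv_comp k hW hψ_diff, fderiv_comp k hV hψ_diff, VectorField.lieBracket]
  exact congrArg₂ (fun y z ↦ fderiv ℝ W (ψ k) y - fderiv ℝ V (ψ k) z) hvV.self_of_nhds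
    hwW.self_of_nhds

end Tangency

section MaximalRank

variable {E F : Type*} [NormedAddCommGroup E] [NormedSpace ℝ E]
  [NormedAddCommGroup F] [NormedSpace ℝ F] [FiniteDimensional ℝ F]

lemma eventually_isUnit_comp_fderiv_and_range_eq_of_maximal_rank {φ : E → F} {t₀ : E}
    {K : Type*} [NormedAddCommGroup K] [NormedSpace ℝ K] [CompleteSpace K]
    {ι : K →L[ℝ] E} {P : F →L[ℝ] K} (hφ : ContDiffAt ℝ 1 φ t₀)
    (hP : IsUnit (P ∘L fderiv ℝ φ t₀ ∘L ι))
    (hmax : ∀ᶠ t in 𝓝 t₀, Module.finrank ℝ (fderiv ℝ φ t).range ≤ Module.finrank ℝ K) :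
    ∀ᶠ k in 𝓝 (0 : K), IsUnit (P ∘L fderiv ℝ (fun k ↦ φ (t₀ + ι k)) k) ∧
      Set.range (fderiv ℝ (fun k ↦ φ (t₀ + ι k)) k) = Set.range (fderiv ℝ φ (t₀ + ι k)) ∧
      Module.finrank ℝ (fderiv ℝ φ (t₀ + ι k)).range = Module.finrank ℝ K := by
  have hparam : Filter.Tendsto (fun k : K ↦ t₀ + ι k) (𝓝 0) (𝓝 t₀) := by
    simpa using (by fun_prop : ContinuousAt (fun k : K ↦ t₀ + ι k) 0).tendsto
  have hunit : ∀ᶠ t in 𝓝 t₀, IsUnit (P ∘L fderiv ℝ φ t ∘L ι) :=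
    (continuousAt_const.clm_comp ((hφ.fderiv_right (m := 0) (by simp)).continuousAt.clm_comp
      continuousAt_const)).eventually (Units.isOpen.mem_nhds hP)
  filter_upwards [hparam.eventually hunit, hparam.eventually (hφ.eventually (by simp)),
    hparam.eventually hmax] with k hk_unit hk_diff hk_rank
  have hchain : fderiv ℝ (fun k ↦ φ (t₀ + ι k)) k = fderiv ℝ φ (t₀ + ι k) ∘L ι :=
    (HasFDerivAt.comp (g := φ) (f := fun k ↦ t₀ + ι k) k
      (hk_diff.differentiableAt (by simp)).hasFDerivAt (ι.hasFDerivAt.const_add t₀)).fderiv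
  rw [hchain]
  have hinj : Function.Injective (fderiv ℝ φ (t₀ + ι k) ∘L ι) :=
    .of_comp (f := P) (ContinuousLinearMap.isUnit_iff_bijective.1 hk_unit).injective
  have hle : (fderiv ℝ φ (t₀ + ι k) ∘L ι).range ≤ (fderiv ℝ φ (t₀ + ι k)).range := by
    rintro _ ⟨l, rfl⟩
    exact ⟨ι l, rfl⟩
  have hrange : (fderiv ℝ φ (t₀ + ι k) ∘L ι).range = (fderiv ℝ φ (t₀ + ι k)).range :=
    Submodule.eq_of_le_of_finrank_le hle (hk_rank.trans (LinearMap.finrank_range_of_inj hinj).ge)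
  exact ⟨hk_unit, congrArg (fun S : Submodule ℝ F ↦ (S : Set F)) hrange,
    hrange ▸ LinearMap.finrank_range_of_inj hinj⟩

lemma exists_immersion_of_maximal_rank {φ : E → F} {t₀ : E} (hφ : ContDiffAt ℝ 1 φ t₀)
    (hmax : ∀ᶠ t in 𝓝 t₀,
      Module.finrank ℝ (fderiv ℝ φ t).range ≤ Module.finrank ℝ (fderiv ℝ φ t₀).range) :
    ∃ (ι : (fderiv ℝ φ t₀).range →L[ℝ] E) (P : F →L[ℝ] (fderiv ℝ φ t₀).range),
      ∀ᶠ k in 𝓝 0, IsUnit (P ∘L fderiv ℝ (fun k ↦ φ (t₀ + ι k)) k) ∧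
        Set.range (fderiv ℝ (fun k ↦ φ (t₀ + ι k)) k) = Set.range (fderiv ℝ φ (t₀ + ι k)) ∧
        Module.finrank ℝ (fderiv ℝ φ (t₀ + ι k)).range =
          Module.finrank ℝ (fderiv ℝ φ t₀).range := by
  obtain ⟨ι, hι⟩ := (fderiv ℝ φ t₀).rangeRestrict.exists_rightInverse_of_surjective
    (LinearMap.range_rangeRestrict _)
  obtain ⟨P, hP⟩ := Submodule.ClosedComplemented.of_finiteDimensional (fderiv ℝ φ t₀).range
  refine ⟨ι, P, eventually_isUnit_comp_fderiv_and_range_eq_of_maximal_rank hφ ?_ hmax⟩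
  suffices P ∘L fderiv ℝ φ t₀ ∘L ι = .id ℝ _ from this ▸ isUnit_one
  refine ContinuousLinearMap.ext fun k ↦ ?_
  have hk : fderiv ℝ φ t₀ (ι k) = k := congrArg Subtype.val (DFunLike.congr_fun hι k)
  simp only [ContinuousLinearMap.comp_apply, hk, hP, ContinuousLinearMap.id_apply]

end MaximalRank

lemma eventually_span_range_eq_top {𝕜 X ι F : Type*} [NontriviallyNormedField 𝕜] [CompleteSpace 𝕜]
    [TopologicalSpace X] [Finite ι] [NormedAddCommGroup F] [NormedSpace 𝕜 F]
    [FiniteDimensional 𝕜 F] {v : X → ι → F} {x₀ : X} (hv : ContinuousAt v x₀)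
    (hspan : Submodule.span 𝕜 (Set.range (v x₀)) = ⊤) :
    ∀ᶠ x in 𝓝 x₀, Submodule.span 𝕜 (Set.range (v x)) = ⊤ := by
  have := Fintype.ofFinite ι
  let combination (x : X) : (ι → 𝕜) →L[𝕜] F :=
    ∑ j, ContinuousLinearMap.smulRightL 𝕜 _ _ (.proj j) (v x j)
  have hsurj (x) : Function.Surjective (combination x) ↔
      Submodule.span 𝕜 (Set.range (v x)) = ⊤ := by
    rw [Submodule.eq_top_iff']
    simp only [Submodule.mem_span_range_iff_exists_fun, Function.Surjective, combination,
      sum_apply, ContinuousLinearMap.smulRightL_apply_apply,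
      ContinuousLinearMap.smulRight_apply, ContinuousLinearMap.proj_apply]
  have hcont : ContinuousAt combination x₀ := by
    have := continuousAt_pi.1 hv
    fun_prop
  simp only [← hsurj] at hspan ⊢
  exact hcont.eventually (isOpen_setOf_surjective_clm.mem_nhds hspan)

section LieHull

variable {d : ℕ} {M : Type*} [TopologicalSpace M] [ChartedSpace (EuclideanSpace ℝ (Fin d)) M]
  {Y : Fin 3 → VectorFieldOn d M}

lemma mem_lieHull (Y : Fin 3 → VectorFieldOn d M) (i : Fin 3) : Y i ∈ lieHull Y :=
  Submodule.mem_sInf.2 fun _ hS ↦ hS.1 i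

lemma mlieBracket_mem_lieHull {V W : VectorFieldOn d M} (hV : V ∈ lieHull Y)
    (hW : W ∈ lieHull Y) : VectorField.mlieBracket (𝓡 d) V W ∈ lieHull Y :=
  Submodule.mem_sInf.2 fun S hS ↦
    hS.2 V (Submodule.mem_sInf.1 hV S hS) W (Submodule.mem_sInf.1 hW S hS)

@[elab_as_elim]
lemma lieHull_induction {p : (V : VectorFieldOn d M) → V ∈ lieHull Y → Prop}
    (hgen : ∀ i, p (Y i) (mem_lieHull Y i)) (hzero : p 0 (zero_mem _))
    (hadd : ∀ V W hV hW, p V hV → p W hW → p (V + W) (add_mem hV hW))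
    (hsmul : ∀ (c : ℝ) V hV, p V hV → p (c • V) (Submodule.smul_mem _ c hV))
    (hbracket : ∀ V W hV hW, p V hV → p W hW →
      p (VectorField.mlieBracket (𝓡 d) V W) (mlieBracket_mem_lieHull hV hW))
    {V : VectorFieldOn d M} (hV : V ∈ lieHull Y) : p V hV := by
  let S : Submodule ℝ (VectorFieldOn d M) :=
    { carrier := {V | ∃ hV, p V hV}
      add_mem' := fun ⟨_, hV⟩ ⟨_, hW⟩ ↦ ⟨_, hadd _ _ _ _ hV hW⟩
      zero_mem' := ⟨_, hzero⟩
      smul_mem' := fun c _ ⟨_, hV⟩ ↦ ⟨_, hsmul c _ _ hV⟩ }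
  have hle : lieHull Y ≤ S := sInf_le
    ⟨fun i ↦ ⟨_, hgen i⟩, fun _ ⟨_, hV⟩ _ ⟨_, hW⟩ ↦ ⟨_, hbracket _ _ _ _ hV hW⟩⟩
  exact (hle hV).2

variable [IsManifold (𝓡 d) ω M]

lemma contMDiff_of_mem_lieHull (hY : ∀ i, IsAnalyticVectorField (Y i)) {V : VectorFieldOn d M}
    (hV : V ∈ lieHull Y) :
    ContMDiff (𝓡 d) (𝓡 d).tangent ∞ (fun x : M ↦ (⟨x, V x⟩ : TangentBundle (𝓡 d) M)) := by
  induction hV using lieHull_induction with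
  | hgen i => exact ContMDiff.of_le (hY i) le_top
  | hzero => exact Bundle.contMDiff_zeroSection ℝ (TangentSpace (𝓡 d) (M := M))
  | hadd V W _ _ hV hW => exact hV.add_section hW
  | hsmul c V _ hV => exact hV.const_smul_section
  | hbracket V W _ _ hV hW =>
    have : IsManifold (𝓡 d) ((⊤ : ℕ∞) + 1) M := IsManifold.of_le (n := ω) le_top
    exact fun x ↦ ContMDiffAt.mlieBracket_vectorField (n := ⊤) (m := ⊤) (hV x) (hW x) (by simp)

lemma contDiffAt_chartField_of_mem_lieHull (hY : ∀ i, IsAnalyticVectorField (Y i))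
    {V : VectorFieldOn d M} (hV : V ∈ lieHull Y) {x₀ : M} {y : EuclideanSpace ℝ (Fin d)}
    (hy : y ∈ (extChartAt (𝓡 d) x₀).target) : ContDiffAt ℝ ∞ (chartField x₀ V) y :=
  contDiffAt_chartField hy (contMDiff_of_mem_lieHull hY hV _)

lemma exists_mem_lieHull_chartField_eq {x₀ : M} (hLie : lieHullAt Y x₀ = ⊤)
    (w : EuclideanSpace ℝ (Fin d)) :
    ∃ V ∈ lieHull Y, chartField x₀ V (extChartAt (𝓡 d) x₀ x₀) = w := by
  have hx₀ := mem_extChartAt_target (I := 𝓡 d) x₀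
  have hw : mfderiv 𝓘(ℝ, EuclideanSpace ℝ (Fin d)) (𝓡 d) (extChartAt (𝓡 d) x₀).symm
      (extChartAt (𝓡 d) x₀ x₀) w ∈ lieHullAt Y ((extChartAt (𝓡 d) x₀).symm
        (extChartAt (𝓡 d) x₀ x₀)) := by
    rw [extChartAt_to_inv, hLie]
    exact Submodule.mem_top
  obtain ⟨V, hV, hVw⟩ := hw
  refine ⟨V, hV, (isInvertible_mfderiv_extChartAt_symm hx₀).injective ?_⟩
  rw [mfderiv_extChartAt_symm_chartField hx₀]
  exact hVw

lemma eventually_exists_mem_lieHull_chartField_eq (hY : ∀ i, IsAnalyticVectorField (Y i))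
    {x₀ : M} (hLie : lieHullAt Y x₀ = ⊤) :
    ∀ᶠ y in 𝓝 (extChartAt (𝓡 d) x₀ x₀), ∀ w, ∃ V ∈ lieHull Y, chartField x₀ V y = w := by
  choose V hV hVw using fun j : Fin d ↦
    exists_mem_lieHull_chartField_eq hLie (EuclideanSpace.basisFun (Fin d) ℝ j)
  have hcont : ContinuousAt (fun y j ↦ chartField x₀ (V j) y) (extChartAt (𝓡 d) x₀ x₀) :=
    continuousAt_pi.2 fun j ↦
      (contDiffAt_chartField_of_mem_lieHull hY (hV j) (mem_extChartAt_target x₀)).continuousAt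
  have hspan : Submodule.span ℝ (Set.range fun j ↦
      chartField x₀ (V j) (extChartAt (𝓡 d) x₀ x₀)) = ⊤ := by
    simpa only [hVw, OrthonormalBasis.coe_toBasis] using
      (EuclideanSpace.basisFun (Fin d) ℝ).toBasis.span_eq
  filter_upwards [eventually_span_range_eq_top hcont hspan] with y hy w
  obtain ⟨c, rfl⟩ := (Submodule.mem_span_range_iff_exists_fun ℝ).1 (hy ▸ Submodule.mem_top (x := w))
  exact ⟨∑ j, c j • V j, sum_mem fun j _ ↦ Submodule.smul_mem _ _ (hV j), by
    simp only [chartField_sum_smul, Finset.sum_apply, Pi.smul_apply]⟩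

lemma eventually_chartField_mem_range_fderiv (hY : ∀ i, IsAnalyticVectorField (Y i)) {x₀ : M}
    {K : Type*} [NormedAddCommGroup K] [NormedSpace ℝ K] [CompleteSpace K]
    {ψ : K → EuclideanSpace ℝ (Fin d)} {P : EuclideanSpace ℝ (Fin d) →L[ℝ] K} {k : K}
    (hψ : ∀ᶠ l in 𝓝 k, ContDiffAt ℝ 2 ψ l) (hP : ∀ᶠ l in 𝓝 k, IsUnit (P ∘L fderiv ℝ ψ l))
    (htarget : ∀ᶠ l in 𝓝 k, ψ l ∈ (extChartAt (𝓡 d) x₀).target)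
    (hgen : ∀ i, ∀ᶠ l in 𝓝 k, chartField x₀ (Y i) (ψ l) ∈ Set.range (fderiv ℝ ψ l))
    {V : VectorFieldOn d M} (hV : V ∈ lieHull Y) :
    ∀ᶠ l in 𝓝 k, chartField x₀ V (ψ l) ∈ Set.range (fderiv ℝ ψ l) := by
  induction hV using lieHull_induction with
  | hgen i => exact hgen i
  | hzero => exact .of_forall fun l ↦ ⟨0, by simp [chartField_zero]⟩
  | hadd V W _ _ hV hW =>
    filter_upwards [hV, hW] with l ⟨v, hv⟩ ⟨w, hw⟩
    exact ⟨v + w, by rw [map_add, hv, hw, chartField_add, Pi.add_apply]⟩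
  | hsmul c V _ hV =>
    filter_upwards [hV] with l ⟨v, hv⟩
    exact ⟨c • v, by rw [map_smul, hv, chartField_smul, Pi.smul_apply]⟩
  | hbracket V W hV_mem hW_mem hV hW =>
    have hne : (∞ : WithTop ℕ∞) ≠ 0 := by simp
    filter_upwards [hψ, hP, htarget, hV.eventually_nhds, hW.eventually_nhds]
      with l hψl hPl hl hVl hWl
    rw [chartField_mlieBracket hl
      ((contMDiff_of_mem_lieHull hY hV_mem _).mdifferentiableAt hne)
      ((contMDiff_of_mem_lieHull hY hW_mem _).mdifferentiableAt hne)]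
    exact lieBracket_mem_range_fderiv hψl hPl
      ((contDiffAt_chartField_of_mem_lieHull hY hV_mem hl).differentiableAt hne)
      ((contDiffAt_chartField_of_mem_lieHull hY hW_mem hl).differentiableAt hne) hVl hWl

end LieHull

section SplittingFamily

variable {d : ℕ} {M : Type*} [TopologicalSpace M] [ChartedSpace (EuclideanSpace ℝ (Fin d)) M]

/-- One step of the splitting scheme, as a function of the three times and the starting point. -/
noncomputable def splittingStep (Y : Fin 3 → VectorFieldOn d M) (p : (Fin 3 → ℝ) × M) : M :=
  vectorFlow (Y 2) (p.1 2) (vectorFlow (Y 1) (p.1 1) (vectorFlow (Y 0) (p.1 0) p.2))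

/-- `m` steps of the splitting scheme, as a function of the starting point and of the times,
which are grouped by steps. -/
noncomputable def splittingFamily (Y : Fin 3 → VectorFieldOn d M) :
    (m : ℕ) → (Fin m → Fin 3 → ℝ) × M → M
  | 0, p => p.2
  | m + 1, p => splittingStep Y (p.1 (Fin.last m), splittingFamily Y m (Fin.init p.1, p.2))

section Snoc

variable {T : Type*} [AddCommGroup T] [Module ℝ T] [TopologicalSpace T] {m : ℕ}

/-- `Fin.snoc` (appending an entry to a tuple) as a continuous linear map. -/
noncomputable def snocCLM (T : Type*) [AddCommGroup T] [Module ℝ T] [TopologicalSpace T] (m : ℕ) :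
    (Fin m → T) × T →L[ℝ] (Fin (m + 1) → T) :=
  .pi (Fin.lastCases (.snd ℝ _ _) fun i ↦ .proj i ∘L .fst ℝ _ _)

lemma snocCLM_last (p : (Fin m → T) × T) : snocCLM T m p (Fin.last m) = p.2 := by
  simp [snocCLM]

lemma init_snocCLM (p : (Fin m → T) × T) : Fin.init (snocCLM T m p) = p.1 := by
  ext i
  simp [snocCLM, Fin.init]

end Snoc

variable {Y : Fin 3 → VectorFieldOn d M}

lemma splittingFamily_snocCLM {m : ℕ} (t : Fin m → Fin 3 → ℝ) (s : Fin 3 → ℝ) (x : M) :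
    splittingFamily Y (m + 1) (snocCLM _ m (t, s), x) =
      splittingStep Y (s, splittingFamily Y m (t, x)) := by
  simp only [splittingFamily, snocCLM_last, init_snocCLM]

lemma splittingStep_single (hc : ∀ i, IsCompleteVectorField (Y i)) (i : Fin 3) (s : ℝ) (x : M) :
    splittingStep Y (Pi.single i s, x) = vectorFlow (Y i) s x := by
  fin_cases i <;> simp [splittingStep, (hc _).vectorFlow_zero]

lemma splittingStep_zero (hc : ∀ i, IsCompleteVectorField (Y i)) (x : M) :
    splittingStep Y (0, x) = x := by
  simp [splittingStep, (hc _).vectorFlow_zero]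

variable [IsManifold (𝓡 d) ω M] [T2Space M]

lemma contMDiff_splittingStep (hc : ∀ i, IsCompleteVectorField (Y i))
    (hY : ∀ i, IsAnalyticVectorField (Y i)) :
    ContMDiff (𝓘(ℝ, Fin 3 → ℝ).prod (𝓡 d)) (𝓡 d) ω (splittingStep Y) := by
  have htime : ∀ i : Fin 3, ContMDiff (𝓘(ℝ, Fin 3 → ℝ).prod (𝓡 d)) 𝓘(ℝ, ℝ) ω
      (fun p : (Fin 3 → ℝ) × M ↦ p.1 i) := fun i ↦
    (ContinuousLinearMap.contMDiff (.proj i : (Fin 3 → ℝ) →L[ℝ] ℝ)).comp contMDiff_fst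
  have hflow := fun i ↦ (hc i).contMDiff_vectorFlow (hY i)
  exact (hflow 2).comp ((htime 2).prodMk ((hflow 1).comp ((htime 1).prodMk
    ((hflow 0).comp ((htime 0).prodMk contMDiff_snd)))))

lemma contMDiff_splittingFamily (hc : ∀ i, IsCompleteVectorField (Y i))
    (hY : ∀ i, IsAnalyticVectorField (Y i)) (m : ℕ) :
    ContMDiff (𝓘(ℝ, Fin m → Fin 3 → ℝ).prod (𝓡 d)) (𝓡 d) ω (splittingFamily Y m) := by
  induction m with
  | zero => exact contMDiff_snd
  | succ m ih =>
    have hlast := ContinuousLinearMap.contMDiff (n := ω)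
      (.proj (Fin.last m) : (Fin (m + 1) → Fin 3 → ℝ) →L[ℝ] (Fin 3 → ℝ))
    have hinit := ContinuousLinearMap.contMDiff (n := ω)
      (.pi fun i : Fin m ↦ .proj i.castSucc : (Fin (m + 1) → Fin 3 → ℝ) →L[ℝ] (Fin m → Fin 3 → ℝ))
    exact (contMDiff_splittingStep hc hY).comp ((hlast.comp contMDiff_fst).prodMk
      (ih.comp ((hinit.comp contMDiff_fst).prodMk contMDiff_snd)))

lemma contMDiff_splittingFamily_left (hc : ∀ i, IsCompleteVectorField (Y i))
    (hY : ∀ i, IsAnalyticVectorField (Y i)) (m : ℕ) (x : M) :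
    ContMDiff 𝓘(ℝ, Fin m → Fin 3 → ℝ) (𝓡 d) ω (fun t ↦ splittingFamily Y m (t, x)) :=
  (contMDiff_splittingFamily hc hY m).comp (contMDiff_id.prodMk contMDiff_const)

end SplittingFamily

section MaximalRankTimes

variable {d : ℕ} {M : Type*} [TopologicalSpace M] [ChartedSpace (EuclideanSpace ℝ (Fin d)) M]

/-- The endpoint of `m` steps of the splitting scheme from `x`, as a function of the times and in
the coordinates of the chart at `x₀`. -/
noncomputable def splittingCoord (Y : Fin 3 → VectorFieldOn d M) (x₀ x : M) (m : ℕ)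
    (t : Fin m → Fin 3 → ℝ) : EuclideanSpace ℝ (Fin d) :=
  extChartAt (𝓡 d) x₀ (splittingFamily Y m (t, x))

variable {Y : Fin 3 → VectorFieldOn d M} {x₀ x : M} {m : ℕ} {t : Fin m → Fin 3 → ℝ}

lemma exists_finrank_range_fderiv_splittingCoord_maximal {O : Set M} (hx : x ∈ O) :
    ∃ m t, splittingFamily Y m (t, x) ∈ O ∧ ∀ m' t', splittingFamily Y m' (t', x) ∈ O →
      Module.finrank ℝ (fderiv ℝ (splittingCoord Y x₀ x m') t').range ≤
        Module.finrank ℝ (fderiv ℝ (splittingCoord Y x₀ x m) t).range := by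
  let ranks : Set ℕ := {r | ∃ m t, splittingFamily Y m (t, x) ∈ O ∧
    Module.finrank ℝ (fderiv ℝ (splittingCoord Y x₀ x m) t).range = r}
  have hranks_nonempty : ranks.Nonempty := ⟨_, 0, 0, hx, rfl⟩
  have hranks_bdd : BddAbove ranks := ⟨d, by
    rintro _ ⟨m, t, -, rfl⟩
    simpa using Submodule.finrank_le (fderiv ℝ (splittingCoord Y x₀ x m) t).range⟩
  obtain ⟨m, t, hmt, hr⟩ := Nat.sSup_mem hranks_nonempty hranks_bdd
  exact ⟨m, t, hmt, fun m' t' h ↦ hr ▸ le_csSup hranks_bdd ⟨m', t', h, rfl⟩⟩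

variable [IsManifold (𝓡 d) ω M]

lemma mfderiv_extChartAt_eq_chartField {y : EuclideanSpace ℝ (Fin d)}
    (hy : y ∈ (extChartAt (𝓡 d) x₀).target) (V : VectorFieldOn d M) :
    mfderiv (𝓡 d) 𝓘(ℝ, EuclideanSpace ℝ (Fin d)) (extChartAt (𝓡 d) x₀)
      ((extChartAt (𝓡 d) x₀).symm y) (V ((extChartAt (𝓡 d) x₀).symm y)) = chartField x₀ V y := by
  rw [← mfderiv_extChartAt_symm_chartField hy V]
  have hinv := mfderiv_extChartAt_comp_mfderivWithin_extChartAt_symm (I := 𝓡 d) hy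
  rw [ModelWithCorners.range_eq_univ, mfderivWithin_univ] at hinv
  exact DFunLike.congr_fun hinv (chartField x₀ V y)

lemma IsCompleteVectorField.hasDerivAt_extChartAt_vectorFlow {V : VectorFieldOn d M}
    (hc : IsCompleteVectorField V) (hx : x ∈ (extChartAt (𝓡 d) x₀).source) :
    HasDerivAt (fun s ↦ extChartAt (𝓡 d) x₀ (vectorFlow V s x))
      (chartField x₀ V (extChartAt (𝓡 d) x₀ x)) 0 := by
  have hcurve : HasMFDerivAt 𝓘(ℝ, ℝ) (𝓡 d) (fun s ↦ vectorFlow V s x) 0 _ :=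
    hc.isMIntegralCurve_vectorFlow x 0
  have hchart := (mdifferentiableAt_extChartAt (I := 𝓡 d)
    (by rwa [extChartAt_source] at hx)).hasMFDerivAt
  rw [← hc.vectorFlow_zero x] at hchart
  obtain ⟨L, hL, hderiv⟩ : ∃ L : ℝ →L[ℝ] EuclideanSpace ℝ (Fin d),
      L 1 = mfderiv (𝓡 d) 𝓘(ℝ, EuclideanSpace ℝ (Fin d)) (extChartAt (𝓡 d) x₀) (vectorFlow V 0 x)
        ((1 : ℝ) • V (vectorFlow V 0 x)) ∧
      HasFDerivAt (fun s ↦ extChartAt (𝓡 d) x₀ (vectorFlow V s x)) L 0 :=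
    ⟨_, rfl, (HasMFDerivAt.comp (0 : ℝ) hchart hcurve).hasFDerivAt⟩
  have hvelocity : ∀ z, z = x → mfderiv (𝓡 d) 𝓘(ℝ, EuclideanSpace ℝ (Fin d))
      (extChartAt (𝓡 d) x₀) z ((1 : ℝ) • V z) = chartField x₀ V (extChartAt (𝓡 d) x₀ x) := by
    rintro _ rfl
    have hfield := mfderiv_extChartAt_eq_chartField ((extChartAt (𝓡 d) x₀).map_source hx) V
    rwa [(extChartAt (𝓡 d) x₀).left_inv hx, ← one_smul ℝ (V _)] at hfield
  exact hderiv.hasDerivAt.congr_deriv (hL.trans (hvelocity _ (hc.vectorFlow_zero x)))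

variable [T2Space M]

lemma contDiffAt_splittingCoord (hc : ∀ i, IsCompleteVectorField (Y i))
    (hY : ∀ i, IsAnalyticVectorField (Y i))
    (ht : splittingFamily Y m (t, x) ∈ (extChartAt (𝓡 d) x₀).source) :
    ContDiffAt ℝ ω (splittingCoord Y x₀ x m) t :=
  contMDiffAt_iff_contDiffAt.1 <| (contMDiffAt_extChartAt'
    (by rwa [extChartAt_source] at ht)).comp t (contMDiff_splittingFamily_left hc hY m x t)

lemma hasFDerivAt_splittingCoord_snocCLM_zero (hc : ∀ i, IsCompleteVectorField (Y i))
    (hY : ∀ i, IsAnalyticVectorField (Y i))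
    (ht : splittingFamily Y m (t, x) ∈ (extChartAt (𝓡 d) x₀).source) :
    HasFDerivAt (splittingCoord Y x₀ x (m + 1))
      (fderiv ℝ (splittingCoord Y x₀ x (m + 1)) (snocCLM _ m (t, 0))) (snocCLM _ m (t, 0)) := by
  refine (ContDiffAt.differentiableAt (n := ω) (contDiffAt_splittingCoord hc hY ?_)
    (by simp)).hasFDerivAt
  rwa [splittingFamily_snocCLM, splittingStep_zero hc]

lemma range_fderiv_splittingCoord_le_succ (hc : ∀ i, IsCompleteVectorField (Y i))
    (hY : ∀ i, IsAnalyticVectorField (Y i))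
    (ht : splittingFamily Y m (t, x) ∈ (extChartAt (𝓡 d) x₀).source) :
    (fderiv ℝ (splittingCoord Y x₀ x m) t).range ≤
      (fderiv ℝ (splittingCoord Y x₀ x (m + 1)) (snocCLM _ m (t, 0))).range := by
  have hsnoc : HasFDerivAt (fun t : Fin m → Fin 3 → ℝ ↦ snocCLM (Fin 3 → ℝ) m (t, 0))
      (snocCLM _ m ∘L .inl ℝ _ _) t :=
    (snocCLM (Fin 3 → ℝ) m ∘L .inl ℝ _ _).hasFDerivAt
  have hcomp : splittingCoord Y x₀ x m =
      splittingCoord Y x₀ x (m + 1) ∘ fun t ↦ snocCLM _ m (t, 0) := by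
    ext1 t
    simp only [splittingCoord, Function.comp_apply, splittingFamily_snocCLM, splittingStep_zero hc]
  have hderiv := (hasFDerivAt_splittingCoord_snocCLM_zero hc hY ht).comp t hsnoc
  rw [← hcomp] at hderiv
  rw [hderiv.fderiv]
  exact LinearMap.range_comp_le_range _ _

lemma chartField_mem_range_fderiv_splittingCoord_succ (hc : ∀ i, IsCompleteVectorField (Y i))
    (hY : ∀ i, IsAnalyticVectorField (Y i))
    (ht : splittingFamily Y m (t, x) ∈ (extChartAt (𝓡 d) x₀).source) (i : Fin 3) :
    chartField x₀ (Y i) (splittingCoord Y x₀ x m t) ∈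
      (fderiv ℝ (splittingCoord Y x₀ x (m + 1)) (snocCLM _ m (t, 0))).range := by
  let direction : ℝ →L[ℝ] (Fin (m + 1) → Fin 3 → ℝ) :=
    snocCLM _ m ∘L .inr ℝ _ _ ∘L .single ℝ (fun _ : Fin 3 ↦ ℝ) i
  have hline (s : ℝ) :
      snocCLM (Fin 3 → ℝ) m (t, 0) + direction s = snocCLM _ m (t, Pi.single i s) := by
    simp [direction, ← map_add]
  have hcomp : (fun s ↦ extChartAt (𝓡 d) x₀ (vectorFlow (Y i) s (splittingFamily Y m (t, x)))) =
      splittingCoord Y x₀ x (m + 1) ∘ fun s ↦ snocCLM _ m (t, 0) + direction s := by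
    ext1 s
    simp only [splittingCoord, Function.comp_apply, hline, splittingFamily_snocCLM,
      splittingStep_single hc]
  have hD := hasFDerivAt_splittingCoord_snocCLM_zero hc hY ht
  rw [← add_zero (snocCLM (Fin 3 → ℝ) m (t, 0)), ← map_zero direction] at hD
  have hderiv := HasFDerivAt.comp (0 : ℝ) hD (direction.hasFDerivAt.const_add _)
  rw [← hcomp, map_zero, add_zero] at hderiv
  exact ⟨direction 1, hderiv.hasDerivAt.unique ((hc i).hasDerivAt_extChartAt_vectorFlow ht)⟩

lemma chartField_mem_range_fderiv_splittingCoord_of_finrank_le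
    (hc : ∀ i, IsCompleteVectorField (Y i)) (hY : ∀ i, IsAnalyticVectorField (Y i))
    (ht : splittingFamily Y m (t, x) ∈ (extChartAt (𝓡 d) x₀).source)
    (hrank : Module.finrank ℝ
        (fderiv ℝ (splittingCoord Y x₀ x (m + 1)) (snocCLM _ m (t, 0))).range ≤
      Module.finrank ℝ (fderiv ℝ (splittingCoord Y x₀ x m) t).range) (i : Fin 3) :
    chartField x₀ (Y i) (splittingCoord Y x₀ x m t) ∈
      (fderiv ℝ (splittingCoord Y x₀ x m) t).range := by
  rw [Submodule.eq_of_le_of_finrank_le (range_fderiv_splittingCoord_le_succ hc hY ht) hrank]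
  exact chartField_mem_range_fderiv_splittingCoord_succ hc hY ht i

lemma chartField_mem_range_fderiv_splittingCoord_of_maximal
    (hc : ∀ i, IsCompleteVectorField (Y i)) (hY : ∀ i, IsAnalyticVectorField (Y i)) {O : Set M}
    (hO : IsOpen O) (hO_source : O ⊆ (extChartAt (𝓡 d) x₀).source)
    (ht : splittingFamily Y m (t, x) ∈ O)
    (hmax : ∀ m' t', splittingFamily Y m' (t', x) ∈ O →
      Module.finrank ℝ (fderiv ℝ (splittingCoord Y x₀ x m') t').range ≤
        Module.finrank ℝ (fderiv ℝ (splittingCoord Y x₀ x m) t).range)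
    {V : VectorFieldOn d M} (hV : V ∈ lieHull Y) :
    chartField x₀ V (splittingCoord Y x₀ x m t) ∈
      Set.range (fderiv ℝ (splittingCoord Y x₀ x m) t) := by
  have hnear : ∀ᶠ t' in 𝓝 t, splittingFamily Y m (t', x) ∈ O :=
    (contMDiff_splittingFamily_left hc hY m x).continuous.continuousAt.eventually (hO.mem_nhds ht)
  obtain ⟨ι, P, himm⟩ := exists_immersion_of_maximal_rank
    ((contDiffAt_splittingCoord hc hY (hO_source ht)).of_le le_top)
    (hnear.mono fun t' ↦ hmax m t')
  have hparam : Filter.Tendsto (fun k ↦ t + ι k) (𝓝 0) (𝓝 t) := by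
    simpa using (by fun_prop : ContinuousAt (fun k ↦ t + ι k) 0).tendsto
  have hparam_near := hparam.eventually hnear
  have hsmooth : ∀ᶠ k in 𝓝 0, ContDiffAt ℝ 2 (fun k ↦ splittingCoord Y x₀ x m (t + ι k)) k :=
    hparam_near.mono fun k hk ↦
      ContDiffAt.comp (g := splittingCoord Y x₀ x m) (f := fun k ↦ t + ι k) k
        ((contDiffAt_splittingCoord hc hY (hO_source hk)).of_le le_top) (by fun_prop)
  have hgen (i : Fin 3) : ∀ᶠ k in 𝓝 0, chartField x₀ (Y i) (splittingCoord Y x₀ x m (t + ι k)) ∈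
      Set.range (fderiv ℝ (fun k ↦ splittingCoord Y x₀ x m (t + ι k)) k) := by
    filter_upwards [himm, hparam_near] with k ⟨_, hrange, hrank⟩ hk
    rw [hrange]
    refine chartField_mem_range_fderiv_splittingCoord_of_finrank_le hc hY (hO_source hk) ?_ i
    refine hrank ▸ hmax _ _ ?_
    rwa [splittingFamily_snocCLM, splittingStep_zero hc]
  have htangent := (eventually_chartField_mem_range_fderiv hY hsmooth (himm.mono fun k hk ↦ hk.1)
    (hparam_near.mono fun k hk ↦ (extChartAt (𝓡 d) x₀).map_source (hO_source hk)) hgen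
    hV).self_of_nhds
  rw [himm.self_of_nhds.2.1] at htangent
  simpa only [map_zero, add_zero] using htangent

theorem exists_surjective_mfderiv_splittingFamily (hc : ∀ i, IsCompleteVectorField (Y i))
    (hY : ∀ i, IsAnalyticVectorField (Y i)) (hLie : lieHullAt Y x₀ = ⊤) :
    ∃ m, 0 < m ∧ ∃ t, Function.Surjective (mfderiv 𝓘(ℝ, Fin m → Fin 3 → ℝ) (𝓡 d)
      (fun t ↦ splittingFamily Y m (t, x₀)) t) := by
  obtain ⟨O, hO_sub, hO, hx₀⟩ := mem_nhds_iff.1 <|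
    ((continuousAt_extChartAt (I := 𝓡 d) x₀).eventually
      (eventually_exists_mem_lieHull_chartField_eq hY hLie)).and
      (extChartAt_source_mem_nhds (I := 𝓡 d) x₀)
  have hO_source : O ⊆ (extChartAt (𝓡 d) x₀).source := fun y hy ↦ (hO_sub hy).2
  obtain ⟨m, t, ht, hmax⟩ :=
    exists_finrank_range_fderiv_splittingCoord_maximal (Y := Y) (x₀ := x₀) hx₀
  have hsurj : (fderiv ℝ (splittingCoord Y x₀ x₀ m) t).range = ⊤ := by
    refine LinearMap.range_eq_top.2 fun w ↦ ?_
    obtain ⟨V, hV, rfl⟩ := (hO_sub ht).1 w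
    exact chartField_mem_range_fderiv_splittingCoord_of_maximal hc hY hO hO_source ht hmax hV
  refine ⟨m + 1, m.succ_pos, snocCLM _ m (t, 0), ?_⟩
  rw [surjective_mfderiv_iff_fderiv_extChartAt (y₀ := x₀)
    ((contMDiff_splittingFamily_left hc hY (m + 1) x₀).mdifferentiable (by simp) _)
    (by simpa only [splittingFamily_snocCLM, splittingStep_zero hc] using hO_source ht)]
  exact LinearMap.range_eq_top.1 <| top_le_iff.1 <|
    hsurj.ge.trans (range_fderiv_splittingCoord_le_succ hc hY (hO_source ht))

end MaximalRankTimes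

/-! ### The transition operator -/

section IndependentLaws

lemma absolutelyContinuous_pi_fin {n : ℕ} {α : Fin n → Type*} [∀ i, MeasurableSpace (α i)]
    {μ ν : ∀ i, Measure (α i)} [∀ i, SigmaFinite (μ i)] [∀ i, SigmaFinite (ν i)]
    (h : ∀ i, μ i ≪ ν i) : Measure.pi μ ≪ Measure.pi ν := by
  induction n with
  | zero => rw [Measure.pi_of_empty μ (isEmptyElim ·), Measure.pi_of_empty ν (isEmptyElim ·)]
  | succ n ih =>
    rw [← ((measurePreserving_piFinSuccAbove μ 0).symm _).map_eq,
      ← ((measurePreserving_piFinSuccAbove ν 0).symm _).map_eq]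
    exact ((h 0).prod (ih fun i ↦ h _)).map (MeasurableEquiv.measurable _)

lemma absolutelyContinuous_pi {ι : Type*} [Fintype ι] {α : ι → Type*}
    [∀ i, MeasurableSpace (α i)] {μ ν : ∀ i, Measure (α i)} [∀ i, SigmaFinite (μ i)]
    [∀ i, SigmaFinite (ν i)] (h : ∀ i, μ i ≪ ν i) : Measure.pi μ ≪ Measure.pi ν := by
  let e := (Fintype.equivFin ι).symm
  rw [← (measurePreserving_piCongrLeft μ e).map_eq, ← (measurePreserving_piCongrLeft ν e).map_eq]
  exact (absolutelyContinuous_pi_fin fun i ↦ h (e i)).map (MeasurableEquiv.measurable _)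

lemma expMeasure_absolutelyContinuous_volume (r : ℝ) : expMeasure r ≪ volume :=
  withDensity_absolutelyContinuous _ _

lemma map_absolutelyContinuous_pi_of_iIndepFun {Ω ι : Type*} [Fintype ι] [MeasurableSpace Ω]
    {P : Measure Ω} {α : ι → Type*} [∀ i, MeasurableSpace (α i)] {X : ∀ i, Ω → α i}
    {ν : ∀ i, Measure (α i)} [∀ i, SigmaFinite (ν i)] (hX : ∀ i, AEMeasurable (X i) P)
    (hX_indep : iIndepFun X P) (hX_law : ∀ i, P.map (X i) ≪ ν i) :
    P.map (fun o i ↦ X i o) ≪ Measure.pi ν := by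
  have := hX_indep.isProbabilityMeasure
  rw [(iIndepFun_iff_map_fun_eq_pi_map hX).1 hX_indep]
  have (i : ι) := Measure.isProbabilityMeasure_map (hX i)
  exact absolutelyContinuous_pi hX_law

end IndependentLaws

section TransitionOperator

variable {d : ℕ} {M : Type*} [TopologicalSpace M] [T2Space M]
  [ChartedSpace (EuclideanSpace ℝ (Fin d)) M] [IsManifold (𝓡 d) ω M] [MeasurableSpace M]
  [BorelSpace M] {Y : Fin 3 → VectorFieldOn d M}
  {Ω : Type*} [MeasurableSpace Ω] {P : Measure Ω} {τ : ℕ → Ω → ℝ}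

lemma kernelOperator_splittingKernel (hc : ∀ i, IsCompleteVectorField (Y i))
    (hY : ∀ i, IsAnalyticVectorField (Y i)) (hτ : AEMeasurable (fun o (i : Fin 3) ↦ τ i o) P)
    {g : M → ℝ} (hg : Measurable g) (x : M) :
    kernelOperator (splittingKernel P Y τ) g x =
      ∫ s, g (splittingStep Y (s, x)) ∂P.map fun o (i : Fin 3) ↦ τ i o := by
  have hstep : Measurable fun s ↦ splittingStep Y (s, x) :=
    ((contMDiff_splittingStep hc hY).continuous.comp (by fun_prop)).measurable
  have hkernel : splittingKernel P Y τ x =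
      (P.map fun o (i : Fin 3) ↦ τ i o).map fun s ↦ splittingStep Y (s, x) := by
    rw [AEMeasurable.map_map_of_aemeasurable hstep.aemeasurable hτ]
    rfl
  rw [kernelOperator, hkernel, integral_map hstep.aemeasurable hg.aestronglyMeasurable]

variable [SecondCountableTopology M]

lemma measurable_integral_comp_splittingStep (hc : ∀ i, IsCompleteVectorField (Y i))
    (hY : ∀ i, IsAnalyticVectorField (Y i)) (η : Measure (Fin 3 → ℝ)) [SFinite η] {g : M → ℝ}
    (hg : Measurable g) : Measurable fun x ↦ ∫ s, g (splittingStep Y (s, x)) ∂η :=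
  ((hg.comp (contMDiff_splittingStep hc hY).continuous.measurable).stronglyMeasurable
    |>.integral_prod_left' (μ := η)).measurable

lemma integral_splittingFamily_succ (hc : ∀ i, IsCompleteVectorField (Y i))
    (hY : ∀ i, IsAnalyticVectorField (Y i)) (η : Measure (Fin 3 → ℝ)) [IsFiniteMeasure η] (m : ℕ)
    {g : M → ℝ} (hg : Measurable g) {C : ℝ} (hC : ∀ x, |g x| ≤ C) (x : M) :
    ∫ t, g (splittingFamily Y (m + 1) (t, x)) ∂Measure.pi (fun _ : Fin (m + 1) ↦ η) =
      ∫ t, ∫ s, g (splittingStep Y (s, splittingFamily Y m (t, x))) ∂η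
        ∂Measure.pi fun _ : Fin m ↦ η := by
  let lastStep (p : (Fin 3 → ℝ) × (Fin m → Fin 3 → ℝ)) : ℝ :=
    g (splittingStep Y (p.1, splittingFamily Y m (p.2, x)))
  have hstep : Measurable (splittingStep Y) :=
    (contMDiff_splittingStep hc hY).continuous.measurable
  have hfamily : Measurable (splittingFamily Y m) :=
    (contMDiff_splittingFamily hc hY m).continuous.measurable
  have hint : Integrable lastStep (η.prod (Measure.pi fun _ : Fin m ↦ η)) :=
    .of_bound (hg.comp (hstep.comp (measurable_fst.prodMk (hfamily.comp
      (measurable_snd.prodMk measurable_const))))).aestronglyMeasurable C (.of_forall fun _ ↦ hC _)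
  rw [← integral_prod_symm lastStep hint, ← (measurePreserving_piFinSuccAbove
    (fun _ : Fin (m + 1) ↦ η) (Fin.last m)).integral_comp' lastStep]
  refine integral_congr_ae (.of_forall fun t ↦ ?_)
  simp [lastStep, splittingFamily, MeasurableEquiv.piFinSuccAbove, Fin.init_def]

lemma iterate_kernelOperator_splittingKernel [IsFiniteMeasure P]
    (hc : ∀ i, IsCompleteVectorField (Y i)) (hY : ∀ i, IsAnalyticVectorField (Y i))
    (hτ : AEMeasurable (fun o (i : Fin 3) ↦ τ i o) P) (m : ℕ) {g : M → ℝ} (hg : Measurable g)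
    (hbdd : ∃ C : ℝ, ∀ x, |g x| ≤ C) (x : M) :
    (kernelOperator (splittingKernel P Y τ))^[m] g x =
      ∫ t, g (splittingFamily Y m (t, x)) ∂Measure.pi fun _ : Fin m ↦
        P.map fun o (i : Fin 3) ↦ τ i o := by
  induction m generalizing g with
  | zero =>
    rw [Function.iterate_zero_apply, Measure.pi_of_empty _ isEmptyElim, integral_dirac]
    rfl
  | succ m ih =>
    obtain ⟨C, hC⟩ := hbdd
    have hQ : kernelOperator (splittingKernel P Y τ) g =
        fun x ↦ ∫ s, g (splittingStep Y (s, x)) ∂P.map fun o (i : Fin 3) ↦ τ i o :=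
      funext (kernelOperator_splittingKernel hc hY hτ hg)
    have hQ_bdd : ∃ C : ℝ, ∀ x, |kernelOperator (splittingKernel P Y τ) g x| ≤ C := by
      refine ⟨C * (P.map fun o (i : Fin 3) ↦ τ i o).real Set.univ, fun x ↦ ?_⟩
      rw [hQ, ← Real.norm_eq_abs]
      exact norm_integral_le_of_norm_le_const (.of_forall fun s ↦ hC (splittingStep Y (s, x)))
    rw [Function.iterate_succ_apply,
      ih (hQ ▸ measurable_integral_comp_splittingStep hc hY _ hg) hQ_bdd, hQ,
      integral_splittingFamily_succ hc hY _ m hg hC]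

end TransitionOperator

theorem mainTheorem11_general {d : ℕ} {M : Type*} [TopologicalSpace M] [T2Space M]
    [SecondCountableTopology M] [ChartedSpace (EuclideanSpace ℝ (Fin d)) M]
    [IsManifold (𝓡 d) ω M] [MeasurableSpace M] [BorelSpace M]
    (Y : Fin 3 → VectorFieldOn d M)
    (hY_analytic : ∀ i, IsAnalyticVectorField (Y i))
    (hY_complete : ∀ i, IsCompleteVectorField (Y i))
    {Ω : Type*} [MeasurableSpace Ω] (P : Measure Ω) [IsFiniteMeasure P]
    (τ : ℕ → Ω → ℝ) (hτ : AEMeasurable (fun o (i : Fin 3) ↦ τ i o) P)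
    (hτ_law : P.map (fun o (i : Fin 3) ↦ τ i o) ≪ volume)
    (x₀ : M) (hLie : lieHullAt Y x₀ = ⊤) :
    ∃ m : ℕ, 0 < m ∧ ∃ U : Set M, IsOpen U ∧ x₀ ∈ U ∧
      StrongFellerOn (kernelOperator (splittingKernel P Y τ))^[m] U := by
  obtain ⟨m, hm, t, hsurj⟩ := exists_surjective_mfderiv_splittingFamily hY_complete hY_analytic hLie
  obtain ⟨U, hU, hx₀, hcont⟩ := exists_isOpen_continuousOn_integral_comp
    (volume : Measure (Fin m → Fin 3 → ℝ)) (contMDiff_splittingFamily hY_complete hY_analytic m)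
    (absolutelyContinuous_pi fun _ ↦ hτ_law) hsurj
  exact ⟨m, hm, U, hU, hx₀, fun g hg hbdd ↦ (hcont g hg hbdd).congr fun x _ ↦
    iterate_kernelOperator_splittingKernel hY_complete hY_analytic hτ m hg hbdd x⟩

theorem mainTheorem11 {d : ℕ} {M : Type*} [TopologicalSpace M] [T2Space M]
    [SecondCountableTopology M] [ChartedSpace (EuclideanSpace ℝ (Fin d)) M]
    [IsManifold (𝓡 d) ω M] [MeasurableSpace M] [BorelSpace M]
    (Y : Fin 3 → VectorFieldOn d M)
    (hY_analytic : ∀ i, IsAnalyticVectorField (Y i))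
    (hY_complete : ∀ i, IsCompleteVectorField (Y i))
    {h : ℝ} (hh : 0 < h)
    {Ω : Type*} [MeasurableSpace Ω] (P : Measure Ω) [IsProbabilityMeasure P]
    (τ : ℕ → Ω → ℝ) (hτ_indep : iIndepFun τ P)
    (hτ_law : ∀ n, HasLaw (τ n) (expMeasure (1 / h)) P)
    (x₀ : M) (hLie : lieHullAt Y x₀ = ⊤) :
    ∃ m : ℕ, 0 < m ∧ ∃ U : Set M, IsOpen U ∧ x₀ ∈ U ∧
      StrongFellerOn (kernelOperator (splittingKernel P Y τ))^[m] U := by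
  have hτ (n : ℕ) : AEMeasurable (τ n) P := (hτ_law n).aemeasurable
  exact mainTheorem11_general Y hY_analytic hY_complete P τ (aemeasurable_pi_iff.2 fun i ↦ hτ i)
    (map_absolutelyContinuous_pi_of_iIndepFun (fun i ↦ hτ i)
      (hτ_indep.precomp Fin.val_injective) fun i ↦
        (hτ_law i).map_eq ▸ expMeasure_absolutelyContinuous_volume _) x₀ hLie
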